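/- Let $d\ge 1$ be an integer, and let $h,a,A$ be reals with $0<h<1$ and $0<a\le 1\le A<\infty$. Let $\lambda_d$ be Lebesgue measure on $[0,1]^d$ and let $\pi$ be a probability measure on $[0,1]^d\times\{-1,1\}$, with $(X,Y)\sim\pi$, marginal $P^X$, and $\eta(x)=\mathbb P(Y=1\mid X=x)$. Write $R(f)=\mathbb P(f(X)\ne Y)$ and let $f^*=\operatorname{sign}(2\eta-1)$ be the Bayes rule. A classifier $\hat f_n$ associates to each sample $D_n=((X_i,Y_i))_{i\le n}$ of i.i.d. variables of law $\pi$ a rule $[0,1]^d\to\{-1,1\}$ (measurably in $(D_n,x)$); its excess risk is $\mathcal E_\pi(\hat f_n)=\mathbb E_\pi[R(\hat f_n)-R(f^*)]$. For $j\in\mathbb N$ and $\mathbf k\in I_d(j)=\{0,\dots,2^j-1\}^d$ let $\mathcal I^{(j)}_{\mathbf k}=\prod_i I^{(j)}_{k_i}$, where $I^{(j)}_k=[k2^{-j},(k+1)2^{-j})$, closed on the right if $k=2^j-1$, and let $\phi^{(j)}_{\mathbf k}$ be its indicator. For $w:\mathbb N\to[0,\infty)$, $\mathcal F^{(d)}_w$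 is the class of the rules $f$ which can be written $f=\sum_{j}\sum_{\mathbf k\in I_d(j)}a^{(j)}_{\mathbf k}\phi^{(j)}_{\mathbf k}$, $P^X$-a.s., with $a^{(j)}_{\mathbf k}\in\{-1,0,1\}$, $\operatorname{card}\{\mathbf k\in I_d(j):a^{(j)}_{\mathbf k}\neq0\}\le w(j)$ for all $j$, and the following writing convention: if $a^{(j)}_{\mathbf k}\ne 0$, then all coefficients of dyadic cells of higher frequency inside $\mathcal I^{(j)}_{\mathbf k}$ are $0$; and, for every cell, the non-zero coefficients of cells of higher frequency inside it are neither all equal to $1$ nor all equal to $-1$, unless there are none. Let $\mathcal P_{w,h,a,A}$ be the set of all $\pi$ such that $P^X\ll\lambda_d$ with $a\le dP^X/d\lambda_d\le A$ a.e. on $[0,1]^d$, $\mathbb P(|2\eta(X)-1|>h)=1$, and $f^*\in\mathcal F_w^{(d)}$. For an integer $K\ge1$ let $\mathcal P_K^{(d)}=\mathcal P_{w,h,a,A}$ with $w(j)=2^{dj}$ for $j\le K$ and $w(j)=2^{dK}$ for $j>K$ (truncated class). For $0<\alpha<1$ let $\mathcal P_\alpha^{(d)}=\mathcal P_{w,h,a,A}$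 with $w(j)=2^{dj}$ for $j\le N$ and $w(j)=2^{d\alpha j}$ for $j>N$, where $N=\min\{m\in\mathbb N:2^{d\alpha m}\ge 2^d-1\}$ (exponential class). For $J\in\mathbb N$, let $\hat f_n^{(J)}=\sum_{\mathbf k\in I_d(J)}\hat A_{\mathbf k}\phi_{\mathbf k}^{(J)}$ be the dyadic majority-vote classifier, where $\hat A_{\mathbf k}=1$ if strictly more of the observations with $X_i\in\mathcal I_{\mathbf k}^{(J)}$ have $Y_i=1$ than $Y_i=-1$, and $\hat A_{\mathbf k}=-1$ otherwise. Put $L_n=\lceil\log(an/(2^d\log n))/(d\log2)\rceil$. We say that $(J_n)$ is of order $L_n$ up to a multiplying constant if $c\,|L_n|\le J_n\le c'\,|L_n|$ for all large $n$, with constants $c,c'>0$, and moreover $|J_n-L_n|$ is bounded over $n\ge2$ (that is, $2^{dJ_n}$ and $an/(2^d\log n)$ agree up to constant factors). **Truncated class.** There are a sequence $(J_n)$ of non-negative integers, of order $L_n$ up to a multiplying constant, and a constant $C>0$, all depending only on $d,K,h,a,A$, such that for all $n\ge2$ $$\sup_{\pi\in\mathcal P_K^{(d)}}\mathcal E_\pi(\hat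 f_n^{(J_n)})\le C\,\frac{\log n}{n};$$ and there is $C_0>0$, depending only on $K,h,a,A$ (not on $d$), such that for all $n\ge1$ $$\inf_{\hat f_n}\sup_{\pi\in\mathcal P_K^{(d)}}\mathcal E_\pi(\hat f_n)\ge C_0\,n^{-1},$$ the infimum being over all classifiers. **Exponential class.** There are a sequence $(J_n)$ of non-negative integers, of order $L_n$ up to a multiplying constant, and constants $C',C_0'>0$, all depending only on $d,\alpha,h,a,A$, such that $$\sup_{\pi\in\mathcal P_\alpha^{(d)}}\mathcal E_\pi(\hat f_n^{(J_n)})\le C'\Big(\frac{\log n}{n}\Big)^{1-\alpha}\quad(n\ge2),\qquad \inf_{\hat f_n}\sup_{\pi\in\mathcal P_\alpha^{(d)}}\mathcal E_\pi(\hat f_n)\ge C_0'\,n^{-1+\alpha}\quad(n\ge1).$$ -/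

import Mathlib

open MeasureTheory ProbabilityTheory Filter Asymptotics
open scoped ENNReal unitInterval

namespace DyadicClassification

/-- The cube `[0,1]^d`, with its product σ-algebra; its `volume` is Lebesgue measure. -/
abbrev Cube (d : ℕ) : Type := Fin d → I

/-- The label set `{-1, 1}`. -/
abbrev Label : Type := ℤˣ

instance : DiscreteMeasurableSpace Label where
  forall_measurableSet s :=
    ⟨Units.val '' s, MeasurableSet.of_discrete,
      Set.preimage_image_eq s Units.val_injective⟩

/-! ### Prediction rules, risk, Bayes rule -/

/-- Misclassification error `R(f) = ℙ(f(X) ≠ Y)`. -/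
noncomputable def risk {d : ℕ} (π : ProbabilityMeasure (Cube d × Label)) (f : Cube d → Label) :
    ℝ :=
  (π : Measure (Cube d × Label)).real {z | f z.1 ≠ z.2}

/-- The marginal `P^X`. -/
noncomputable def marginal {d : ℕ} (π : ProbabilityMeasure (Cube d × Label)) :
    Measure (Cube d) :=
  (π : Measure (Cube d × Label)).fst

/-- The conditional probability function `η(x) = ℙ(Y = 1 | X = x)`. -/
noncomputable def eta {d : ℕ} (π : ProbabilityMeasure (Cube d × Label)) (x : Cube d) : ℝ :=
  ((π : Measure (Cube d × Label)).condKernel x).real {1}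

open Classical in
/-- The Bayes rule `f* = sign(2η - 1)`. -/
noncomputable def bayesRule {d : ℕ} (π : ProbabilityMeasure (Cube d × Label)) (x : Cube d) :
    Label :=
  if 0 ≤ 2 * eta π x - 1 then 1 else -1

/-- A classifier based on `n` observations: a (jointly measurable) map which associates a
prediction rule to every sample. -/
structure Classifier (d n : ℕ) where
  toFun : (Fin n → Cube d × Label) → Cube d → Label
  measurable' : Measurable (Function.uncurry toFun)

/-- The excess risk `E_π[R(f̂_n) - R(f*)]`, the sample being i.i.d. with law `π`. -/
noncomputable def excessRisk {d n : ℕ} (π : ProbabilityMeasure (Cube d × Label))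
    (f : Classifier d n) : ℝ :=
  ∫ D, (risk π (f.toFun D) - risk π (bayesRule π))
    ∂(Measure.pi fun _ : Fin n => (π : Measure (Cube d × Label)))

/-! ### Dyadic cells and the majority-vote classifier -/

/-- The interval `[k/2^j, (k+1)/2^j)`, closed on the right when `k = 2^j - 1`. -/
def dyadicInterval (j : ℕ) (k : Fin (2 ^ j)) : Set I :=
  {x | (k : ℝ) / 2 ^ j ≤ x ∧ ((x : ℝ) < ((k : ℝ) + 1) / 2 ^ j ∨ (k : ℕ) = 2 ^ j - 1)}

/-- The dyadic cell of frequency `j` and multi-index `k ∈ {0, …, 2^j - 1}^d`. -/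
def dyadicCell {d : ℕ} (j : ℕ) (k : Fin d → Fin (2 ^ j)) : Set (Cube d) :=
  {x | ∀ i, x i ∈ dyadicInterval j (k i)}

open Classical in
/-- Number of observations in the cell with label `y`. -/
noncomputable def cellCount {d n : ℕ} (J : ℕ) (k : Fin d → Fin (2 ^ J)) (y : Label)
    (D : Fin n → Cube d × Label) : ℕ :=
  (Finset.univ.filter fun i => (D i).1 ∈ dyadicCell J k ∧ (D i).2 = y).card

open Classical in
/-- The majority vote in a cell: `1` if the cell has strictly more observations labelled `1` than
labelled `-1` (so it contains an observation), and `-1` otherwise. -/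
noncomputable def majorityCoeff {d n : ℕ} (J : ℕ) (D : Fin n → Cube d × Label)
    (k : Fin d → Fin (2 ^ J)) : Label :=
  if cellCount J k (-1) D < cellCount J k 1 D then 1 else -1

open Classical in
/-- The rule equal to `majorityCoeff J D k` on the cell of index `k`; see
`majorityRule_eq_sum`. -/
noncomputable def majorityRule {d n : ℕ} (J : ℕ) (D : Fin n → Cube d × Label) (x : Cube d) :
    Label :=
  if ∃ k, x ∈ dyadicCell J k ∧ majorityCoeff J D k = 1 then 1 else -1

theorem dyadicInterval_existsUnique (j : ℕ) (x : I) : ∃! k, x ∈ dyadicInterval j k := by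
  have hp : (0 : ℝ) < 2 ^ j := by positivity
  have hpn : 0 < 2 ^ j := by positivity
  have hx0 : (0 : ℝ) ≤ x := x.2.1
  have hx1 : (x : ℝ) ≤ 1 := x.2.2
  have hy0 : (0 : ℝ) ≤ x * 2 ^ j := by positivity
  have key : ∀ k : Fin (2 ^ j), x ∈ dyadicInterval j k ↔
      (k : ℕ) = min ⌊(x : ℝ) * 2 ^ j⌋₊ (2 ^ j - 1) := by
    intro k
    have hk := k.2
    have hfl : ∀ m : ℕ, m ≤ ⌊(x : ℝ) * 2 ^ j⌋₊ ↔ (m : ℝ) ≤ x * 2 ^ j :=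
      fun m => Nat.le_floor_iff hy0
    have h1 : ((k : ℝ) / 2 ^ j ≤ x) ↔ (k : ℕ) ≤ ⌊(x : ℝ) * 2 ^ j⌋₊ := by
      rw [hfl, div_le_iff₀ hp]
    have h2 : ((x : ℝ) < ((k : ℝ) + 1) / 2 ^ j) ↔ ⌊(x : ℝ) * 2 ^ j⌋₊ < (k : ℕ) + 1 := by
      rw [lt_div_iff₀ hp, Nat.floor_lt hy0]; push_cast; rfl
    simp only [dyadicInterval, Set.mem_ofPred_eq, h1, h2]
    omega
  refine ⟨⟨min ⌊(x : ℝ) * 2 ^ j⌋₊ (2 ^ j - 1), by omega⟩, (key _).2 rfl, fun k hk => ?_⟩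
  exact Fin.ext ((key k).1 hk)

theorem dyadicCell_existsUnique {d : ℕ} (j : ℕ) (x : Cube d) : ∃! k, x ∈ dyadicCell j k := by
  choose k hk huniq using fun i => dyadicInterval_existsUnique j (x i)
  exact ⟨k, hk, fun k' hk' => funext fun i => huniq i _ (hk' i)⟩

/-- The majority rule is `∑_k Â_k φ_k`, with `φ_k` the indicator of the cell of index `k`. -/
theorem majorityRule_eq_sum {d n : ℕ} (J : ℕ) (D : Fin n → Cube d × Label) (x : Cube d) :
    ((majorityRule J D x : Label) : ℤ) =
      ∑ k, ((majorityCoeff J D k : Label) : ℤ) * (dyadicCell J k).indicator 1 x := by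
  classical
  obtain ⟨k₀, hk₀, huniq⟩ := dyadicCell_existsUnique J x
  rw [Finset.sum_eq_single k₀]
  · have : (∃ k, x ∈ dyadicCell J k ∧ majorityCoeff J D k = 1) ↔ majorityCoeff J D k₀ = 1 :=
      ⟨fun ⟨k, hk, h⟩ => huniq k hk ▸ h, fun h => ⟨k₀, hk₀, h⟩⟩
    rw [majorityRule, Set.indicator_of_mem hk₀]
    simp only [this]
    by_cases h : majorityCoeff J D k₀ = 1
    · simp [h]
    · have : majorityCoeff J D k₀ = -1 := (Int.units_eq_one_or _).resolve_left h
      simp [this]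
  · intro k _ hk
    rw [Set.indicator_of_notMem (fun h => hk (huniq k h)), mul_zero]
  · simp

theorem measurableSet_dyadicCell {d : ℕ} (j : ℕ) (k : Fin d → Fin (2 ^ j)) :
    MeasurableSet (dyadicCell j k) := by
  have h : ∀ k : Fin (2 ^ j), MeasurableSet (dyadicInterval j k) := by
    intro k
    have hc : Measurable fun x : I => (x : ℝ) := measurable_subtype_coe
    exact (measurableSet_le measurable_const hc).inter
      ((measurableSet_lt hc measurable_const).union (MeasurableSet.const _))
  have : dyadicCell j k = ⋂ i, (fun x : Cube d => x i) ⁻¹' dyadicInterval j (k i) := by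
    ext x; simp [dyadicCell]
  rw [this]
  exact MeasurableSet.iInter fun i => measurable_pi_apply i (h _)

theorem measurable_cellCount {d n : ℕ} (J : ℕ) (k : Fin d → Fin (2 ^ J)) (y : Label) :
    Measurable (cellCount (n := n) J k y) := by
  classical
  have : cellCount (n := n) J k y = fun D => ∑ i : Fin n,
      if (D i).1 ∈ dyadicCell J k ∧ (D i).2 = y then 1 else 0 := by
    funext D
    rw [cellCount, Finset.card_filter]
  rw [this]
  refine Finset.measurable_sum _ fun i _ => Measurable.ite ?_ measurable_const measurable_const
  have hi : Measurable fun D : Fin n → Cube d × Label => D i := measurable_pi_apply i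
  exact (hi.fst (measurableSet_dyadicCell J k)).inter (hi.snd (measurableSet_singleton y))

theorem measurable_majorityRule {d n : ℕ} (J : ℕ) :
    Measurable (Function.uncurry (majorityRule (d := d) (n := n) J)) := by
  classical
  have hs : MeasurableSet {p : (Fin n → Cube d × Label) × Cube d |
      ∃ k, p.2 ∈ dyadicCell J k ∧ majorityCoeff J p.1 k = 1} := by
    have : {p : (Fin n → Cube d × Label) × Cube d |
        ∃ k, p.2 ∈ dyadicCell J k ∧ majorityCoeff J p.1 k = 1} =
        ⋃ k, {p | p.2 ∈ dyadicCell J k} ∩ {p | cellCount J k (-1) p.1 < cellCount J k 1 p.1} := by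
      ext p
      simp only [majorityCoeff, Set.mem_ofPred_eq, Set.mem_iUnion, Set.mem_inter_iff]
      refine exists_congr fun k => and_congr_right fun _ => ?_
      split_ifs with h
      · simp [h]
      · simp only [h, iff_false]; decide
    rw [this]
    exact MeasurableSet.iUnion fun k => (measurable_snd (measurableSet_dyadicCell J k)).inter
      (measurableSet_lt ((measurable_cellCount J k _).comp measurable_fst)
        ((measurable_cellCount J k _).comp measurable_fst))
  have : Function.uncurry (majorityRule (d := d) (n := n) J) = fun p =>
      if p ∈ {p : (Fin n → Cube d × Label) × Cube d |
        ∃ k, p.2 ∈ dyadicCell J k ∧ majorityCoeff J p.1 k = 1} then 1 else -1 := by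
    funext p
    simp only [Function.uncurry, majorityRule, Set.mem_ofPred_eq]
  rw [this]
  exact Measurable.ite hs measurable_const measurable_const

/-- The dyadic majority-vote classifier `f̂_n^{(J)}` at frequency rank `J`. -/
noncomputable def majorityClassifier (d n J : ℕ) : Classifier d n where
  toFun := majorityRule J
  measurable' := measurable_majorityRule J

/-! ### Sparse classes of prediction rules -/

/-- Families of coefficients `a_k^{(j)} ∈ {-1, 0, 1}`. -/
abbrev Coeffs (d : ℕ) : Type := (j : ℕ) → (Fin d → Fin (2 ^ j)) → SignType

/-- The cell `(j', k')` is strictly finer than `(j, k)` and meets it (hence lies inside it). -/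
def Below {d : ℕ} {j j' : ℕ} (k : Fin d → Fin (2 ^ j)) (k' : Fin d → Fin (2 ^ j')) : Prop :=
  j < j' ∧ (dyadicCell j k ∩ dyadicCell j' k').Nonempty

/-- The writing convention (W): nothing non-zero lies below a non-zero coefficient, and the
non-zero coefficients below a knot of the tree are not all `1`, nor all `-1` (otherwise this value
is to be put at the knot itself). -/
structure WritingConvention {d : ℕ} (c : Coeffs d) : Prop where
  zero_below : ∀ j j' (k : Fin d → Fin (2 ^ j)) (k' : Fin d → Fin (2 ^ j')),
    Below k k' → c j k ≠ 0 → c j' k' = 0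
  not_constant_below : ∀ j (k : Fin d → Fin (2 ^ j)),
    (∃ (j' : ℕ) (k' : Fin d → Fin (2 ^ j')), Below k k' ∧ c j' k' ≠ 0) →
      (∃ (j' : ℕ) (k' : Fin d → Fin (2 ^ j')), Below k k' ∧ c j' k' = 1) ∧
      (∃ (j' : ℕ) (k' : Fin d → Fin (2 ^ j')), Below k k' ∧ c j' k' = -1)

/-- The value at `x` of `∑_j ∑_k c_k^{(j)} φ_k^{(j)}`. Under the writing convention, the sum over
`j` has at most one non-zero term. -/
noncomputable def dyadicSum {d : ℕ} (c : Coeffs d) (x : Cube d) : ℤ :=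
  ∑ᶠ j : ℕ, ∑ k : Fin d → Fin (2 ^ j), (c j k : ℤ) * (dyadicCell j k).indicator 1 x

/-- The class `F_w^{(d)}` of prediction rules (defined `P`-almost surely). -/
def sparseClass {d : ℕ} (w : ℕ → ℝ) (P : Measure (Cube d)) : Set (Cube d → Label) :=
  {f | ∃ c : Coeffs d, WritingConvention c ∧
    (∀ j, (Nat.card {k : Fin d → Fin (2 ^ j) // c j k ≠ 0} : ℝ) ≤ w j) ∧
    ∀ᵐ x ∂P, ((f x : Label) : ℤ) = dyadicSum c x}

/-- The weight of the truncated class of level `K`. -/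
noncomputable def truncatedWeight (d K : ℕ) (j : ℕ) : ℝ :=
  if j ≤ K then 2 ^ (d * j) else 2 ^ (d * K)

/-- `N^{(d)}(α) = inf {N ∈ ℕ : 2^{dαN} ≥ 2^d - 1}`. -/
noncomputable def expThreshold (d : ℕ) (α : ℝ) : ℕ :=
  sInf {N : ℕ | (2 : ℝ) ^ d - 1 ≤ (2 : ℝ) ^ ((d : ℝ) * α * N)}

/-- The weight of the exponential class of parameter `α`. -/
noncomputable def expWeight (d : ℕ) (α : ℝ) (j : ℕ) : ℝ :=
  if j ≤ expThreshold d α then 2 ^ (d * j) else (2 : ℝ) ^ ((d : ℝ) * α * j)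

/-! ### Statistical models and the rank -/

/-- (A1): `P` has a Lebesgue density with values in `[a, A]`. -/
def DensityAssumption {d : ℕ} (a A : ℝ) (P : Measure (Cube d)) : Prop :=
  P ≪ volume ∧ ∀ᵐ x ∂(volume : Measure (Cube d)),
    ENNReal.ofReal a ≤ P.rnDeriv volume x ∧ P.rnDeriv volume x ≤ ENNReal.ofReal A

/-- (SMA): `|2η(X) - 1| > h` almost surely. -/
def StrongMargin {d : ℕ} (h : ℝ) (π : ProbabilityMeasure (Cube d × Label)) : Prop :=
  ∀ᵐ x ∂(marginal π), h < |2 * eta π x - 1|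

/-- The model `𝒫_{w,h,a,A}`. -/
def model (d : ℕ) (w : ℕ → ℝ) (h a A : ℝ) : Set (ProbabilityMeasure (Cube d × Label)) :=
  {π | DensityAssumption a A (marginal π) ∧ StrongMargin h π ∧
    bayesRule π ∈ sparseClass w (marginal π)}

/-- The worst-case excess risk of a classifier over a set of distributions. -/
noncomputable def worstRisk {d n : ℕ} (Q : Set (ProbabilityMeasure (Cube d × Label)))
    (f : Classifier d n) : EReal :=
  ⨆ π ∈ Q, (excessRisk π f : EReal)

/-- The minimax excess risk over all classifiers based on `n` observations. -/
noncomputable def minimaxExcessRisk (d n : ℕ) (Q : Set (ProbabilityMeasure (Cube d × Label))) : EReal :=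
  ⨅ f : Classifier d n, worstRisk Q f

/-- `⌈log(a n / (2^d log n)) / (d log 2)⌉`. -/
noncomputable def referenceRank (d : ℕ) (a : ℝ) (n : ℕ) : ℤ :=
  ⌈Real.log (a * n / (2 ^ d * Real.log n)) / (d * Real.log 2)⌉

/-- `J_n` is of the order of `referenceRank d a n`, up to a multiplying constant: the two sequences
are of the same order, and moreover differ by a bounded amount, that is `2^{d J_n}` and
`a n / (2^d log n)` are equal up to a multiplying constant. -/
def HasReferenceOrder (d : ℕ) (a : ℝ) (J : ℕ → ℕ) : Prop :=
  ((fun n => (J n : ℝ)) =Θ[atTop] fun n => (referenceRank d a n : ℝ)) ∧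
    ∃ M : ℝ, ∀ n : ℕ, 2 ≤ n → |(J n : ℝ) - referenceRank d a n| ≤ M

end DyadicClassification

open DyadicClassification

/-!
Upper bounds. On a cell where `f*` is almost surely constant, the strong margin biases every vote
towards `f*`, so by Chernoff's bound the majority errs with a probability exponentially small in
the mass of the cell. The other cells of frequency `J` only meet non-zero coefficients of frequency
larger than `J`, so their total mass is at most the geometric sum of `A w(j) 2^{-dj}` over `j > J`.
The choice of `J` balances the two terms.

Lower bounds. Flipping the label of a cell of mass of order `1/n` cannot be detected from `n`
observations, so Assouad's method applies to the rules with arbitrary labels on the cells of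
frequency `J` of a corner cell of frequency `i₀` and value `-1` elsewhere. Confinement to one corner
cell keeps the coefficients of these rules sparse; imposing `-1` on the cell of the origin saves one
coefficient at each frequency `j ≤ i₀`, which is what the weight `2^d - 1` requires.
-/

namespace DyadicClassification

/-! ### Probability estimates -/

section Sections

variable {Ω X : Type*} [MeasurableSpace Ω] [MeasurableSpace X]

theorem integrable_measureReal_section_left {μ : Measure Ω} [IsFiniteMeasure μ] {ν : Measure X}
    [IsFiniteMeasure ν] {S : Set (Ω × X)} (hS : MeasurableSet S) :
    Integrable (fun ω => ν.real {x | (ω, x) ∈ S}) μ :=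
  .of_bound (measurable_measure_prodMk_left hS).ennreal_toReal.aestronglyMeasurable
    (ν.real Set.univ) (ae_of_all _ fun _ => by
      rw [Real.norm_of_nonneg measureReal_nonneg]
      exact measureReal_mono (Set.subset_univ _))

theorem integrable_measureReal_section_right {μ : Measure Ω} [IsFiniteMeasure μ] {ν : Measure X}
    [IsFiniteMeasure ν] {S : Set (Ω × X)} (hS : MeasurableSet S) :
    Integrable (fun x => μ.real {ω | (ω, x) ∈ S}) ν :=
  integrable_measureReal_section_left (measurable_swap hS)

theorem integral_measureReal_section_comm {μ : Measure Ω} [IsFiniteMeasure μ] {ν : Measure X}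
    [IsFiniteMeasure ν] {S : Set (Ω × X)} (hS : MeasurableSet S) :
    ∫ ω, ν.real {x | (ω, x) ∈ S} ∂μ = ∫ x, μ.real {ω | (ω, x) ∈ S} ∂ν := by
  calc ∫ ω, ν.real {x | (ω, x) ∈ S} ∂μ = (∫⁻ ω, ν (Prod.mk ω ⁻¹' S) ∂μ).toReal :=
        integral_toReal (measurable_measure_prodMk_left hS).aemeasurable
          (ae_of_all _ fun _ => measure_lt_top _ _)
    _ = (∫⁻ x, μ ((fun ω => (ω, x)) ⁻¹' S) ∂ν).toReal := by
        rw [← Measure.prod_apply hS, Measure.prod_apply_symm hS]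
    _ = ∫ x, μ.real {ω | (ω, x) ∈ S} ∂ν :=
        (integral_toReal (measurable_measure_prodMk_right hS).aemeasurable
          (ae_of_all _ fun _ => measure_lt_top _ _)).symm

end Sections

section TwoPoints

variable {Ω : Type*} [MeasurableSpace Ω] {μ μ' : Measure Ω} [IsFiniteMeasure μ]
  [IsFiniteMeasure μ'] {E : Set Ω}

theorem measureReal_le_add_compl_of_restrict_eq (hE : MeasurableSet E)
    (h : μ.restrict E = μ'.restrict E) (S : Set Ω) :
    μ.real E ≤ μ.real S + μ'.real Sᶜ := by
  have hcompl : μ.real (Sᶜ ∩ E) = μ'.real (Sᶜ ∩ E) := by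
    rw [← measureReal_restrict_apply' hE, h, measureReal_restrict_apply' hE]
  calc μ.real E ≤ μ.real (S ∪ Sᶜ ∩ E) := measureReal_mono fun ω hω => by
        by_cases hS : ω ∈ S
        exacts [.inl hS, .inr ⟨hS, hω⟩]
    _ ≤ μ.real S + μ'.real (Sᶜ ∩ E) := hcompl ▸ measureReal_union_le _ _
    _ ≤ μ.real S + μ'.real Sᶜ := by gcongr; exacts [measure_ne_top _ _, Set.inter_subset_left]

end TwoPoints

theorem card_mul_le_sum_of_involutive {α : Type*} [Fintype α] {s : α → α}
    (hs : Function.Involutive s) {F : α → ℝ} {c : ℝ} (h : ∀ a, c ≤ F a + F (s a)) :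
    Fintype.card α * (c / 2) ≤ ∑ a, F a := by
  have hsum : ∑ a, F (s a) = ∑ a, F a := Equiv.sum_comp hs.toPerm F
  have := Finset.sum_le_sum fun a (_ : a ∈ Finset.univ) => h a
  rw [Finset.sum_add_distrib, hsum, Finset.sum_const, Finset.card_univ, nsmul_eq_mul] at this
  linarith

theorem measureReal_iUnion_le_of_le_geometric {Ω : Type*} [MeasurableSpace Ω] {μ : Measure Ω}
    {S : ℕ → Set Ω} {M q : ℝ} (hM : 0 ≤ M) (hq0 : 0 ≤ q) (hq1 : q < 1)
    (hfin : ∀ i, μ (S i) ≠ ∞) (hS : ∀ i, μ.real (S i) ≤ M * q ^ i) :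
    μ.real (⋃ i, S i) ≤ M * (1 - q)⁻¹ := by
  have hsum : HasSum (fun i => M * q ^ i) (M * (1 - q)⁻¹) :=
    (hasSum_geometric_of_lt_one hq0 hq1).mul_left M
  refine ENNReal.toReal_le_of_le_ofReal (mul_nonneg hM (inv_nonneg.2 (by linarith))) ?_
  calc μ (⋃ i, S i) ≤ ∑' i, μ (S i) := measure_iUnion_le S
    _ ≤ ∑' i, ENNReal.ofReal (M * q ^ i) :=
        ENNReal.tsum_le_tsum fun i => (ENNReal.le_ofReal_iff_toReal_le (hfin i)
          (by positivity)).2 (hS i)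
    _ = ENNReal.ofReal (M * (1 - q)⁻¹) := by
        rw [← hsum.tsum_eq, ENNReal.ofReal_tsum_of_nonneg (fun i => by positivity) hsum.summable]

section Chernoff

variable {Z : Type*} {S T : Set Z}

/-- The multiplicative weight of an observation in the Chernoff bound for a vote of `S` against
`T`: it is `r` on `S`, `r⁻¹` on `T` and `1` elsewhere, when `S` and `T` are disjoint. -/
noncomputable def voteWeight (S T : Set Z) (r : ℝ) (z : Z) : ℝ :=
  1 + S.indicator (fun _ => r - 1) z + T.indicator (fun _ => r⁻¹ - 1) z

open Classical in
theorem voteWeight_eq_mul (hST : Disjoint S T) (r : ℝ) (z : Z) :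
    voteWeight S T r z = (if z ∈ S then r else 1) * (if z ∈ T then r⁻¹ else 1) := by
  by_cases hS : z ∈ S
  · simp [voteWeight, hS, Set.disjoint_left.1 hST hS]
  · by_cases hT : z ∈ T <;> simp [voteWeight, hS, hT]

open Classical in
theorem prod_voteWeight (hST : Disjoint S T) (r : ℝ) {ι : Type*} [Fintype ι] (D : ι → Z) :
    ∏ i, voteWeight S T r (D i) =
      r ^ (Finset.univ.filter fun i => D i ∈ S).card *
        r⁻¹ ^ (Finset.univ.filter fun i => D i ∈ T).card := by
  simp only [voteWeight_eq_mul hST, Finset.prod_mul_distrib, Finset.prod_ite, Finset.prod_const,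
    one_pow, mul_one]

variable [MeasurableSpace Z] {ρ : Measure Z} [IsProbabilityMeasure ρ]

theorem integrable_voteWeight (hS : MeasurableSet S) (hT : MeasurableSet T) (r : ℝ) :
    Integrable (voteWeight S T r) ρ :=
  ((integrable_const _).add ((integrable_const _).indicator hS)).add
    ((integrable_const _).indicator hT)

theorem integral_voteWeight (hS : MeasurableSet S) (hT : MeasurableSet T) (r : ℝ) :
    ∫ z, voteWeight S T r z ∂ρ = 1 + ρ.real S * (r - 1) + ρ.real T * (r⁻¹ - 1) := by
  have hS' : Integrable (S.indicator fun _ => r - 1) ρ := (integrable_const _).indicator hS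
  have hT' : Integrable (T.indicator fun _ => r⁻¹ - 1) ρ := (integrable_const _).indicator hT
  calc ∫ z, voteWeight S T r z ∂ρ = ∫ z, (1 + S.indicator (fun _ => r - 1) z) ∂ρ +
        ∫ z, T.indicator (fun _ => r⁻¹ - 1) z ∂ρ := integral_add ((integrable_const _).add hS') hT'
    _ = _ := by
        rw [integral_add (integrable_const _) hS', integral_indicator_const _ hS,
          integral_indicator_const _ hT]
        simp

-- The optimal tilt is `√((1 - h) / (1 + h))`, of which `1 - h` is the first-order approximation.
theorem integral_voteWeight_one_sub_le (hS : MeasurableSet S) (hT : MeasurableSet T) {h : ℝ}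
    (hh0 : 0 ≤ h) (hh1 : h < 1) (hle : ρ.real T ≤ (1 - h) / 2 * (ρ.real S + ρ.real T)) :
    ∫ z, voteWeight S T (1 - h) z ∂ρ ≤ 1 - h ^ 2 / 2 * (ρ.real S + ρ.real T) := by
  have h1h : 0 < 1 - h := by linarith
  have hcoef : 0 ≤ h + ((1 - h)⁻¹ - 1) := by
    have : 1 ≤ (1 - h)⁻¹ := (one_le_inv₀ h1h).2 (by linarith)
    linarith
  have hbalance : (1 - h) / 2 * (ρ.real S + ρ.real T) * (h + ((1 - h)⁻¹ - 1)) =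
      (ρ.real S + ρ.real T) * (h - h ^ 2 / 2) := by
    field_simp
    ring
  rw [integral_voteWeight hS hT]
  linarith [mul_le_mul_of_nonneg_right hle hcoef]

open Classical in
theorem measureReal_card_le_card_le_exp (hST : Disjoint S T) (hS : MeasurableSet S)
    (hT : MeasurableSet T) {h : ℝ} (hh0 : 0 ≤ h) (hh1 : h < 1)
    (hle : ρ.real T ≤ (1 - h) / 2 * (ρ.real S + ρ.real T)) {ι : Type*} [Fintype ι] :
    (Measure.pi fun _ : ι => ρ).real
        {D | (Finset.univ.filter fun i => D i ∈ S).card ≤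
          (Finset.univ.filter fun i => D i ∈ T).card} ≤
      Real.exp (-(h ^ 2 / 2 * (Fintype.card ι * (ρ.real S + ρ.real T)))) := by
  have h1h : 0 < 1 - h := by linarith
  have hpos : ∀ z, 0 ≤ voteWeight S T (1 - h) z := fun z => by
    rw [voteWeight_eq_mul hST]
    positivity
  have hint : Integrable (fun D : ι → Z => ∏ i, voteWeight S T (1 - h) (D i))
      (Measure.pi fun _ => ρ) := .fintype_prod fun _ => integrable_voteWeight hS hT _
  have hmarkov := mul_meas_ge_le_integral_of_nonneg
    (ae_of_all _ fun D => Finset.prod_nonneg fun i _ => hpos (D i)) hint 1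
  rw [one_mul, integral_fintype_prod_eq_pow] at hmarkov
  calc _ ≤ (∫ z, voteWeight S T (1 - h) z ∂ρ) ^ Fintype.card ι := by
        refine (measureReal_mono fun D hD => ?_).trans hmarkov
        change 1 ≤ ∏ i, voteWeight S T (1 - h) (D i)
        rw [prod_voteWeight hST, inv_pow, ← div_eq_mul_inv, one_le_div (by positivity)]
        exact pow_le_pow_of_le_one h1h.le (by linarith) hD
    _ ≤ Real.exp (-(h ^ 2 / 2 * (ρ.real S + ρ.real T))) ^ Fintype.card ι :=
        pow_le_pow_left₀ (integral_nonneg hpos)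
          ((integral_voteWeight_one_sub_le hS hT hh0 hh1 hle).trans
            (Real.one_sub_le_exp_neg _)) _
    _ = _ := by
        rw [← Real.exp_nat_mul]
        ring_nf

end Chernoff

/-! ### Indices of dyadic cells -/

section CellIndex

variable {d : ℕ}

/-- The multi-index of the dyadic cell of frequency `j` containing `x`. -/
noncomputable def cellIndex (j : ℕ) (x : Cube d) : Fin d → Fin (2 ^ j) :=
  (dyadicCell_existsUnique j x).choose

theorem mem_dyadicCell_iff {j : ℕ} {x : Cube d} {k : Fin d → Fin (2 ^ j)} :
    x ∈ dyadicCell j k ↔ cellIndex j x = k := by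
  have hspec := (dyadicCell_existsUnique j x).choose_spec
  exact ⟨fun hk => (hspec.2 k hk).symm, fun hk => hk ▸ hspec.1⟩

theorem mem_dyadicCell_cellIndex (j : ℕ) (x : Cube d) : x ∈ dyadicCell j (cellIndex j x) :=
  mem_dyadicCell_iff.2 rfl

theorem preimage_cellIndex_singleton (j : ℕ) (k : Fin d → Fin (2 ^ j)) :
    cellIndex j ⁻¹' {k} = dyadicCell j k :=
  Set.ext fun _ => mem_dyadicCell_iff.symm

theorem measurable_cellIndex (j : ℕ) : Measurable (cellIndex (d := d) j) :=
  measurable_to_countable' fun k => preimage_cellIndex_singleton j k ▸ measurableSet_dyadicCell j k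

theorem mem_dyadicInterval_div {j i : ℕ} {x : I} {k : Fin (2 ^ (j + i))}
    (hx : x ∈ dyadicInterval (j + i) k) :
    x ∈ dyadicInterval j
      ⟨k / 2 ^ i, Nat.div_lt_of_lt_mul (by rw [← pow_add, add_comm i]; exact k.2)⟩ := by
  have hle : (k / 2 ^ i : ℕ) * 2 ^ i ≤ (k : ℕ) := Nat.div_mul_le_self _ _
  have hlt : (k : ℕ) + 1 ≤ (k / 2 ^ i + 1) * 2 ^ i :=
    Nat.lt_mul_of_div_lt (Nat.lt_succ_self _) (by positivity)
  have hscale : ∀ y : ℝ, y / 2 ^ j = y * 2 ^ i / 2 ^ (j + i) := fun y => by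
    rw [pow_add]
    field_simp
  constructor
  · refine le_trans ?_ hx.1
    rw [hscale]
    gcongr
    exact_mod_cast hle
  · rcases hx.2 with hx' | hx'
    · refine .inl (hx'.trans_le ?_)
      rw [hscale]
      gcongr
      exact_mod_cast hlt
    · have hpred : (2 ^ (j + i) - 1) / 2 ^ i = 2 ^ j - 1 := by
        rw [pow_add, mul_comm]
        simpa using Nat.mul_sub_div 0 (2 ^ i) (2 ^ j) (by positivity)
      exact .inr ((congrArg (· / 2 ^ i) hx').trans hpred)

theorem cellIndex_div {j j' : ℕ} (h : j ≤ j') (x : Cube d) (i : Fin d) :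
    (cellIndex j x i : ℕ) = cellIndex j' x i / 2 ^ (j' - j) := by
  obtain ⟨m, rfl⟩ := Nat.exists_eq_add_of_le h
  rw [Nat.add_sub_cancel_left]
  exact congrArg Fin.val ((dyadicInterval_existsUnique j (x i)).unique
    (mem_dyadicCell_cellIndex j x i)
    (mem_dyadicInterval_div (mem_dyadicCell_cellIndex (j + m) x i)))

theorem cellIndex_eq_of_le {j j' : ℕ} (h : j ≤ j') {x y : Cube d}
    (hxy : cellIndex j' x = cellIndex j' y) : cellIndex j x = cellIndex j y := by
  ext i
  rw [cellIndex_div h, cellIndex_div h, hxy]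

theorem cellIndex_surjective (j : ℕ) : Function.Surjective (cellIndex (d := d) j) := fun k => by
  have hp : (0 : ℝ) < 2 ^ j := by positivity
  have hk : ∀ i, ((k i : ℕ) : ℝ) / 2 ^ j ∈ I := fun i =>
    ⟨by positivity, (div_le_one hp).2 (by exact_mod_cast (k i).2.le)⟩
  refine ⟨fun i => ⟨k i / 2 ^ j, hk i⟩, mem_dyadicCell_iff.1 fun i => ⟨le_rfl, .inl ?_⟩⟩
  change ((k i : ℕ) : ℝ) / 2 ^ j < _
  gcongr
  exact lt_add_one _

instance : IsProbabilityMeasure (volume : Measure (Cube d)) :=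
  inferInstanceAs (IsProbabilityMeasure (Measure.pi fun _ : Fin d => (volume : Measure I)))

theorem volume_dyadicInterval (j : ℕ) (k : Fin (2 ^ j)) :
    volume (dyadicInterval j k) = ENNReal.ofReal ((2 ^ j)⁻¹) := by
  have hp : (0 : ℝ) < 2 ^ j := by positivity
  have hk : ((k : ℕ) : ℝ) + 1 ≤ 2 ^ j := by exact_mod_cast k.2
  let l : I := ⟨k / 2 ^ j, by positivity, (div_le_one hp).2 (by linarith)⟩
  let u : I := ⟨(k + 1) / 2 ^ j, by positivity, (div_le_one hp).2 hk⟩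
  have hlen : (u : ℝ) - l = (2 ^ j)⁻¹ := by
    simp only [u, l]
    field_simp
    ring
  rw [← hlen]
  refine le_antisymm ?_ ?_
  · rw [← unitInterval.volume_Icc]
    refine measure_mono fun x hx => ⟨hx.1, ?_⟩
    refine hx.2.elim (fun h => le_of_lt h) fun h => ?_
    have hu : u = 1 := Subtype.ext <| (div_eq_one_iff_eq hp.ne').2 <| by
      exact_mod_cast show (k : ℕ) + 1 = 2 ^ j by omega
    exact hu ▸ x.2.2
  · rw [← unitInterval.volume_Ico]
    exact measure_mono fun x hx => ⟨hx.1, .inl hx.2⟩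

theorem volume_dyadicCell {j : ℕ} (k : Fin d → Fin (2 ^ j)) :
    volume (dyadicCell j k) = ENNReal.ofReal ((2 ^ (d * j))⁻¹) := by
  have hpi : dyadicCell j k = Set.univ.pi fun i => dyadicInterval j (k i) :=
    Set.ext fun x => by simp [dyadicCell]
  rw [hpi, volume_pi_pi]
  simp only [volume_dyadicInterval, Finset.prod_const, Finset.card_univ, Fintype.card_fin]
  rw [← ENNReal.ofReal_pow (by positivity), inv_pow, ← pow_mul, mul_comm]

theorem volume_real_dyadicCell {j : ℕ} (k : Fin d → Fin (2 ^ j)) :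
    volume.real (dyadicCell j k) = (2 ^ (d * j))⁻¹ := by
  rw [Measure.real, volume_dyadicCell, ENNReal.toReal_ofReal (by positivity)]

theorem volume_real_preimage_cellIndex {j : ℕ} (T : Finset (Fin d → Fin (2 ^ j))) :
    volume.real (cellIndex j ⁻¹' (T : Set (Fin d → Fin (2 ^ j)))) = T.card * (2 ^ (d * j))⁻¹ := by
  rw [← sum_measureReal_preimage_singleton T fun k _ => measurable_cellIndex j (.singleton k)]
  simp only [preimage_cellIndex_singleton, volume_real_dyadicCell, Finset.sum_const, nsmul_eq_mul]

end CellIndex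

/-! ### Excess risk -/

theorem neg_label_ne_self (y : Label) : -y ≠ y := by
  rcases Int.units_eq_one_or y with rfl | rfl <;> decide

theorem compl_singleton_label (y : Label) : ({y}ᶜ : Set Label) = {-y} :=
  Set.ext fun _ => Int.units_ne_iff_eq_neg

section Risk

variable {d n : ℕ} (π : ProbabilityMeasure (Cube d × Label))

instance : IsProbabilityMeasure (marginal π) := by
  unfold marginal
  infer_instance

theorem measurable_eta : Measurable (eta π) :=
  (Kernel.measurable_coe _ (measurableSet_singleton _)).ennreal_toReal

theorem abs_two_mul_eta_sub_one_le_one (x : Cube d) : |2 * eta π x - 1| ≤ 1 := by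
  have h0 : 0 ≤ eta π x := measureReal_nonneg
  have h1 : eta π x ≤ 1 := measureReal_le_one
  rw [abs_le]
  constructor <;> linarith

theorem integrable_abs_two_mul_eta_sub_one :
    Integrable (fun x => |2 * eta π x - 1|) (marginal π) :=
  .of_bound (((measurable_eta π).const_mul 2).sub_const 1).abs.aestronglyMeasurable 1
    (ae_of_all _ fun x => by simpa using abs_two_mul_eta_sub_one_le_one π x)

theorem measurable_bayesRule : Measurable (bayesRule π) := by
  classical
  exact Measurable.ite (measurableSet_le measurable_const
    (((measurable_eta π).const_mul 2).sub_const 1)) measurable_const measurable_const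

theorem condKernel_real_neg (x : Cube d) (y : Label) :
    ((π : Measure (Cube d × Label)).condKernel x).real {-y} =
      1 - ((π : Measure (Cube d × Label)).condKernel x).real {y} := by
  rw [← compl_singleton_label, probReal_compl_eq_one_sub (measurableSet_singleton y)]

theorem condKernel_real_neg_bayesRule (x : Cube d) :
    ((π : Measure (Cube d × Label)).condKernel x).real {-bayesRule π x} =
      (1 - |2 * eta π x - 1|) / 2 := by
  rw [condKernel_real_neg]
  by_cases hx : 0 ≤ 2 * eta π x - 1
  · rw [bayesRule, if_pos hx, abs_of_nonneg hx, ← eta]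
    ring
  · rw [bayesRule, if_neg hx, abs_of_neg (not_le.1 hx), condKernel_real_neg, ← eta]
    ring

theorem integrable_condKernel_real_neg {f : Cube d → Label} (hf : Measurable f) :
    Integrable (fun x => ((π : Measure (Cube d × Label)).condKernel x).real {-f x})
      (marginal π) := by
  have hmeas : Measurable fun x => ((π : Measure (Cube d × Label)).condKernel x).real {-f x} :=
    (Kernel.measurable_kernel_prodMk_left (κ := (π : Measure (Cube d × Label)).condKernel)
      (measurableSet_eq_fun measurable_snd (hf.neg.comp measurable_fst))).ennreal_toReal
  exact .of_bound hmeas.aestronglyMeasurable 1 (ae_of_all _ fun _ =>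
    (Real.norm_of_nonneg measureReal_nonneg).trans_le measureReal_le_one)

theorem risk_eq_integral_condKernel {f : Cube d → Label} (hf : Measurable f) :
    risk π f = ∫ x, ((π : Measure (Cube d × Label)).condKernel x).real {-f x} ∂(marginal π) := by
  have herr : {z : Cube d × Label | f z.1 ≠ z.2} = {z | z.2 = -f z.1} :=
    Set.ext fun z => ne_comm.trans Int.units_ne_iff_eq_neg
  have hmeas : MeasurableSet {z : Cube d × Label | z.2 = -f z.1} :=
    measurableSet_eq_fun measurable_snd (hf.neg.comp measurable_fst)
  rw [risk, herr, Measure.real, ← Measure.lintegral_condKernel_mem hmeas]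
  exact (integral_toReal (Kernel.measurable_kernel_prodMk_left hmeas).aemeasurable
    (ae_of_all _ fun _ => measure_lt_top _ _)).symm

theorem risk_sub_risk_bayesRule {f : Cube d → Label} (hf : Measurable f) :
    risk π f - risk π (bayesRule π) =
      ∫ x in {x | f x ≠ bayesRule π x}, |2 * eta π x - 1| ∂(marginal π) := by
  have hmeas := measurable_bayesRule π
  have hne : MeasurableSet {x | f x ≠ bayesRule π x} := (measurableSet_eq_fun hf hmeas).compl
  rw [risk_eq_integral_condKernel π hf, risk_eq_integral_condKernel π hmeas,
    ← integral_sub (integrable_condKernel_real_neg π hf) (integrable_condKernel_real_neg π hmeas),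
    ← integral_indicator hne]
  congr 1 with x
  by_cases hx : f x = bayesRule π x
  · simp [hx]
  · rw [Set.indicator_of_mem (by exact hx), Int.units_ne_iff_eq_neg.1 hx, neg_neg,
      condKernel_real_neg_bayesRule, ← neg_neg (bayesRule π x), condKernel_real_neg,
      condKernel_real_neg_bayesRule]
    ring

theorem risk_sub_risk_bayesRule_le {f : Cube d → Label} (hf : Measurable f) :
    risk π f - risk π (bayesRule π) ≤ (marginal π).real {x | f x ≠ bayesRule π x} := by
  rw [risk_sub_risk_bayesRule π hf, ← setIntegral_one_eq_measureReal]
  exact setIntegral_mono (integrable_abs_two_mul_eta_sub_one π).integrableOn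
    (integrable_const _).integrableOn (abs_two_mul_eta_sub_one_le_one π)

theorem StrongMargin.mul_measureReal_le {h : ℝ} {π : ProbabilityMeasure (Cube d × Label)}
    (hπ : StrongMargin h π) {f : Cube d → Label} (hf : Measurable f) :
    h * (marginal π).real {x | f x ≠ bayesRule π x} ≤ risk π f - risk π (bayesRule π) := by
  rw [risk_sub_risk_bayesRule π hf, mul_comm, ← smul_eq_mul, ← setIntegral_const]
  exact setIntegral_mono_ae (integrable_const _).integrableOn
    (integrable_abs_two_mul_eta_sub_one π).integrableOn (hπ.mono fun _ => le_of_lt)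

theorem Classifier.measurable_toFun (g : Classifier d n) (D : Fin n → Cube d × Label) :
    Measurable (g.toFun D) :=
  g.measurable'.comp measurable_prodMk_left

theorem measurable_risk (g : Classifier d n) : Measurable fun D => risk π (g.toFun D) := by
  have herr : MeasurableSet {p : (Fin n → Cube d × Label) × (Cube d × Label) |
      g.toFun p.1 p.2.1 ≠ p.2.2} :=
    (measurableSet_eq_fun (g.measurable'.comp (measurable_fst.prodMk measurable_snd.fst))
      measurable_snd.snd).compl
  exact (measurable_measure_prodMk_left herr).ennreal_toReal

theorem integrable_risk_sub (g : Classifier d n) (r : ℝ)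
    (μ : Measure (Fin n → Cube d × Label)) [IsFiniteMeasure μ] :
    Integrable (fun D => risk π (g.toFun D) - r) μ :=
  (Integrable.of_bound (measurable_risk π g).aestronglyMeasurable 1
    (ae_of_all _ fun _ => (Real.norm_of_nonneg measureReal_nonneg).trans_le
      measureReal_le_one)).sub (integrable_const r)

theorem measurableSet_toFun_ne (g : Classifier d n) {f : Cube d → Label} (hf : Measurable f) :
    MeasurableSet {p : (Fin n → Cube d × Label) × Cube d | g.toFun p.1 p.2 ≠ f p.2} :=
  (measurableSet_eq_fun g.measurable' (hf.comp measurable_snd)).compl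

theorem excessRisk_le_integral (g : Classifier d n) :
    excessRisk π g ≤ ∫ x, (Measure.pi fun _ : Fin n => (π : Measure (Cube d × Label))).real
      {D | g.toFun D x ≠ bayesRule π x} ∂(marginal π) := by
  have hS := measurableSet_toFun_ne g (measurable_bayesRule π)
  refine le_of_le_of_eq ?_ (integral_measureReal_section_comm hS)
  exact integral_mono (integrable_risk_sub π g _ _) (integrable_measureReal_section_left hS)
    fun D => risk_sub_risk_bayesRule_le π (g.measurable_toFun D)

theorem StrongMargin.mul_integral_le_excessRisk {h : ℝ}
    {π : ProbabilityMeasure (Cube d × Label)} (hπ : StrongMargin h π) (g : Classifier d n) :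
    h * ∫ x, (Measure.pi fun _ : Fin n => (π : Measure (Cube d × Label))).real
      {D | g.toFun D x ≠ bayesRule π x} ∂(marginal π) ≤ excessRisk π g := by
  have hS := measurableSet_toFun_ne g (measurable_bayesRule π)
  refine le_of_eq_of_le (congrArg (h * ·) (integral_measureReal_section_comm hS).symm) ?_
  rw [← integral_const_mul]
  exact integral_mono ((integrable_measureReal_section_left hS).const_mul h)
    (integrable_risk_sub π g _ _) fun D => hπ.mul_measureReal_le (g.measurable_toFun D)

end Risk

/-! ### Densities -/

section Density

variable {d : ℕ} {a A : ℝ} {P : Measure (Cube d)} [IsFiniteMeasure P]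

instance : P.HaveLebesgueDecomposition volume :=
  Measure.haveLebesgueDecomposition_of_sigmaFinite _ _

theorem DensityAssumption.mul_volume_real_le (hP : DensityAssumption a A P) (ha : 0 ≤ a)
    (B : Set (Cube d)) : a * volume.real B ≤ P.real B := by
  have hle : ENNReal.ofReal a * volume B ≤ P B := by
    rw [← Measure.setLIntegral_rnDeriv hP.1, ← setLIntegral_const]
    exact lintegral_mono_ae (ae_restrict_of_ae (hP.2.mono fun _ hx => hx.1))
  simpa [Measure.real, ENNReal.toReal_mul, ha] using ENNReal.toReal_mono (measure_ne_top P B) hle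

theorem DensityAssumption.measureReal_le (hP : DensityAssumption a A P) (hA : 0 ≤ A)
    (B : Set (Cube d)) : P.real B ≤ A * volume.real B := by
  have hle : P B ≤ ENNReal.ofReal A * volume B := by
    rw [← Measure.setLIntegral_rnDeriv hP.1, ← setLIntegral_const]
    exact lintegral_mono_ae (ae_restrict_of_ae (hP.2.mono fun _ hx => hx.2))
  simpa [Measure.real, ENNReal.toReal_mul, hA] using
    ENNReal.toReal_mono (ENNReal.mul_ne_top ENNReal.ofReal_ne_top (measure_ne_top _ B)) hle

end Density

/-! ### Sparse classes -/

section SparseClass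

variable {d : ℕ} {P : Measure (Cube d)} {f : Cube d → Label} {c : Coeffs d}

theorem dyadicSum_eq_finsum (c : Coeffs d) (x : Cube d) :
    dyadicSum c x = ∑ᶠ j : ℕ, (c j (cellIndex j x) : ℤ) := by
  classical
  refine finsum_congr fun j => ?_
  simp [Set.indicator_apply, mem_dyadicCell_iff]

theorem WritingConvention.dyadicSum_eq (hc : WritingConvention c) {j : ℕ} {x : Cube d}
    (hj : c j (cellIndex j x) ≠ 0) : dyadicSum c x = c j (cellIndex j x) := by
  have hmeet : ∀ i i', (dyadicCell i (cellIndex i x) ∩ dyadicCell i' (cellIndex i' x)).Nonempty :=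
    fun i i' => ⟨x, mem_dyadicCell_cellIndex i x, mem_dyadicCell_cellIndex i' x⟩
  rw [dyadicSum_eq_finsum]
  refine finsum_eq_single _ j fun i hi => ?_
  suffices h0 : c i (cellIndex i x) = 0 by rw [h0]; rfl
  rcases lt_or_gt_of_ne hi with hlt | hlt
  · by_contra h0
    exact hj (hc.zero_below _ _ _ _ ⟨hlt, hmeet i j⟩ h0)
  · exact hc.zero_below _ _ _ _ ⟨hlt, hmeet j i⟩ hj

theorem exists_ne_zero_of_dyadicSum_ne_zero {x : Cube d} (h : dyadicSum c x ≠ 0) :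
    ∃ j, c j (cellIndex j x) ≠ 0 := by
  contrapose! h
  simp [dyadicSum_eq_finsum, h]

/-- The union of the dyadic cells of frequency `J` on which `f` is not almost surely constant:
outside it, a majority vote at frequency `J` estimates a constant. -/
def mixedRegion (P : Measure (Cube d)) (f : Cube d → Label) (J : ℕ) : Set (Cube d) :=
  {x | ¬ EventuallyConst f (ae (P.restrict (dyadicCell J (cellIndex J x))))}

theorem measurableSet_mixedRegion (P : Measure (Cube d)) (f : Cube d → Label) (J : ℕ) :
    MeasurableSet (mixedRegion P f J) :=
  measurable_cellIndex J (MeasurableSet.of_discrete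
    (s := {k | ¬ EventuallyConst f (ae (P.restrict (dyadicCell J k)))}))

theorem WritingConvention.mixedRegion_ae_le (hc : WritingConvention c)
    (hf : ∀ᵐ x ∂P, ((f x : Label) : ℤ) = dyadicSum c x) (J : ℕ) :
    (mixedRegion P f J : Set (Cube d)) ≤ᵐ[P] ⋃ i, {x | c (J + i) (cellIndex (J + i) x) ≠ 0} := by
  filter_upwards [hf] with x hx hmixed
  obtain ⟨j, hj⟩ := exists_ne_zero_of_dyadicSum_ne_zero (hx ▸ Units.ne_zero (f x))
  have hJj : J ≤ j := by
    by_contra! hlt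
    refine hmixed (eventuallyConst_iff_exists_eventuallyEq.2 ⟨f x, ?_⟩)
    refine (ae_restrict_iff' (measurableSet_dyadicCell J _)).2 ?_
    filter_upwards [hf] with y hy hyJ
    have hcell := cellIndex_eq_of_le hlt.le (mem_dyadicCell_iff.1 hyJ)
    rw [hc.dyadicSum_eq (by rwa [hcell]), hcell, ← hc.dyadicSum_eq hj, ← hx] at hy
    exact Units.ext hy
  exact Set.mem_iUnion.2 ⟨j - J, by rwa [Nat.add_sub_cancel' hJj]⟩

theorem DensityAssumption.measureReal_coeff_ne_zero_le [IsFiniteMeasure P] {a A w : ℝ}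
    (hP : DensityAssumption a A P) (hA : 0 ≤ A) {j : ℕ}
    (hcard : (Nat.card {k : Fin d → Fin (2 ^ j) // c j k ≠ 0} : ℝ) ≤ w) :
    P.real {x | c j (cellIndex j x) ≠ 0} ≤ A * (w * (2 ^ (d * j))⁻¹) := by
  classical
  have hpre : {x | c j (cellIndex j x) ≠ 0} =
      cellIndex j ⁻¹' ((Finset.univ.filter fun k => c j k ≠ 0 : Finset _) : Set _) := by
    ext x
    simp
  refine (hP.measureReal_le hA _).trans ?_
  rw [hpre, volume_real_preimage_cellIndex, ← Fintype.card_subtype, ← Nat.card_eq_fintype_card]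
  gcongr

theorem two_rpow_mul_inv_two_pow (d : ℕ) (α : ℝ) (j : ℕ) :
    (2 : ℝ) ^ ((d : ℝ) * α * j) * (2 ^ (d * j))⁻¹ = ((2 : ℝ) ^ (-((d : ℝ) * (1 - α)))) ^ j := by
  rw [← Real.rpow_natCast 2 (d * j), ← Real.rpow_neg zero_le_two, ← Real.rpow_add zero_lt_two,
    ← Real.rpow_mul_natCast zero_le_two]
  push_cast
  ring_nf

theorem inv_two_pow_rpow (d : ℕ) (α : ℝ) (j : ℕ) :
    ((2 ^ (d * j) : ℝ)⁻¹) ^ (1 - α) = ((2 : ℝ) ^ (-((d : ℝ) * (1 - α)))) ^ j := by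
  rw [← Real.rpow_natCast 2 (d * j), ← Real.rpow_neg zero_le_two, ← Real.rpow_mul zero_le_two,
    ← Real.rpow_mul_natCast zero_le_two]
  push_cast
  ring_nf

theorem DensityAssumption.measureReal_mixedRegion_le [IsFiniteMeasure P] {a A W α : ℝ}
    (hP : DensityAssumption a A P) (hA : 0 ≤ A) (hW : 0 ≤ W) (hd : 1 ≤ d) (hα : α < 1)
    {w : ℕ → ℝ} (hw : ∀ j, w j ≤ W * (2 : ℝ) ^ ((d : ℝ) * α * j)) (hf : f ∈ sparseClass w P)
    (J : ℕ) :
    P.real (mixedRegion P f J) ≤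
      A * W * (1 - (2 : ℝ) ^ (-((d : ℝ) * (1 - α))))⁻¹ * ((2 ^ (d * J) : ℝ)⁻¹) ^ (1 - α) := by
  obtain ⟨c, hc, hcard, hsum⟩ := hf
  set q : ℝ := (2 : ℝ) ^ (-((d : ℝ) * (1 - α))) with hq
  have hd' : (0 : ℝ) < d := by exact_mod_cast hd
  have hq1 : q < 1 := Real.rpow_lt_one_of_one_lt_of_neg one_lt_two
    (neg_lt_zero.2 (mul_pos hd' (by linarith)))
  have hlevel : ∀ i, P.real {x | c (J + i) (cellIndex (J + i) x) ≠ 0} ≤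
      A * W * q ^ J * q ^ i := fun i => by
    refine (hP.measureReal_coeff_ne_zero_le hA ((hcard _).trans (hw _))).trans_eq ?_
    rw [mul_assoc W, two_rpow_mul_inv_two_pow, ← hq, pow_add]
    ring
  calc P.real (mixedRegion P f J)
      ≤ P.real (⋃ i, {x | c (J + i) (cellIndex (J + i) x) ≠ 0}) :=
        ENNReal.toReal_mono (measure_ne_top _ _) (measure_mono_ae (hc.mixedRegion_ae_le hsum J))
    _ ≤ A * W * q ^ J * (1 - q)⁻¹ := measureReal_iUnion_le_of_le_geometric (by positivity)
        (by positivity) hq1 (fun _ => measure_ne_top _ _) hlevel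
    _ = A * W * (1 - q)⁻¹ * ((2 ^ (d * J) : ℝ)⁻¹) ^ (1 - α) := by
        rw [inv_two_pow_rpow, ← hq]
        ring

end SparseClass

theorem ae_eventuallyEq_of_notMem_mixedRegion {d : ℕ} (P : Measure (Cube d))
    (f : Cube d → Label) (J : ℕ) :
    ∀ᵐ x ∂P, x ∉ mixedRegion P f J →
      f =ᵐ[P.restrict (dyadicCell J (cellIndex J x))] fun _ => f x := by
  have hcell : ∀ k : Fin d → Fin (2 ^ J), ∀ᵐ x ∂P, x ∈ dyadicCell J k →
      EventuallyConst f (ae (P.restrict (dyadicCell J k))) →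
      f =ᵐ[P.restrict (dyadicCell J k)] fun _ => f x := fun k => by
    by_cases hk : EventuallyConst f (ae (P.restrict (dyadicCell J k)))
    · obtain ⟨s, hs⟩ := hk.eventuallyEq_const
      filter_upwards [(ae_restrict_iff' (measurableSet_dyadicCell J k)).1 hs] with x hx hxk _
      exact hx hxk ▸ hs
    · exact ae_of_all _ fun _ _ h => absurd h hk
  filter_upwards [ae_all_iff.2 hcell] with x hx hmem
  exact hx _ (mem_dyadicCell_cellIndex J x) (not_not.1 hmem)

/-! ### Risk of the majority vote -/

section Majority

variable {d n : ℕ} {π : ProbabilityMeasure (Cube d × Label)} {h : ℝ}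

theorem measureReal_prod_singleton (π : ProbabilityMeasure (Cube d × Label)) {B : Set (Cube d)}
    (hB : MeasurableSet B) (y : Label) :
    (π : Measure (Cube d × Label)).real (B ×ˢ {y}) =
      ∫ x in B, ((π : Measure (Cube d × Label)).condKernel x).real {y} ∂(marginal π) := by
  rw [Measure.real,
    ← Measure.setLIntegral_condKernel_eq_measure_prod hB (measurableSet_singleton y)]
  exact (integral_toReal (Kernel.measurable_coe _ (measurableSet_singleton y)).aemeasurable
    (ae_of_all _ fun _ => measure_lt_top _ _)).symm

theorem marginal_real_eq_add (π : ProbabilityMeasure (Cube d × Label)) {B : Set (Cube d)}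
    (hB : MeasurableSet B) (y : Label) :
    (marginal π).real B = (π : Measure (Cube d × Label)).real (B ×ˢ {y}) +
      (π : Measure (Cube d × Label)).real (B ×ˢ {-y}) := by
  rw [← measureReal_union (Set.disjoint_prod.2 (.inr (Set.disjoint_singleton.2
      (neg_label_ne_self y).symm))) (hB.prod (measurableSet_singleton _)), ← Set.prod_union,
    ← compl_singleton_label, Set.union_compl_self, Set.prod_univ, marginal, Measure.real,
    Measure.real, Measure.fst_apply hB]

theorem StrongMargin.measureReal_prod_neg_le (hπ : StrongMargin h π) {B : Set (Cube d)}
    (hB : MeasurableSet B) {y : Label} (hy : bayesRule π =ᵐ[(marginal π).restrict B] fun _ => y) :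
    (π : Measure (Cube d × Label)).real (B ×ˢ {-y}) ≤ (1 - h) / 2 * (marginal π).real B := by
  rw [measureReal_prod_singleton π hB, mul_comm, ← smul_eq_mul, ← setIntegral_const]
  refine integral_mono_ae ?_ (integrable_const _) ?_
  · exact (integrable_condKernel_real_neg π measurable_const).integrableOn
  · filter_upwards [hy, ae_restrict_of_ae hπ] with x hx hmargin
    rw [← hx, condKernel_real_neg_bayesRule]
    linarith

theorem cellCount_le_of_majorityCoeff_ne {J : ℕ} {k : Fin d → Fin (2 ^ J)} {y : Label}
    {D : Fin n → Cube d × Label} (hne : majorityCoeff J D k ≠ y) :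
    cellCount J k y D ≤ cellCount J k (-y) D := by
  rcases Int.units_eq_one_or y with rfl | rfl <;> by_contra! hlt
  · exact hne (if_pos hlt)
  · exact hne (if_neg (by rw [neg_neg] at hlt; exact hlt.not_gt))

theorem majorityRule_eq (J : ℕ) (D : Fin n → Cube d × Label) (x : Cube d) :
    majorityRule J D x = majorityCoeff J D (cellIndex J x) := by
  apply Units.ext
  rw [majorityRule_eq_sum]
  classical
  simp [Set.indicator_apply, mem_dyadicCell_iff]

theorem StrongMargin.measureReal_majorityCoeff_ne_le (hπ : StrongMargin h π) (hh0 : 0 ≤ h)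
    (hh1 : h < 1) {J : ℕ} {k : Fin d → Fin (2 ^ J)} {y : Label}
    (hy : bayesRule π =ᵐ[(marginal π).restrict (dyadicCell J k)] fun _ => y) :
    (Measure.pi fun _ : Fin n => (π : Measure (Cube d × Label))).real
      {D | majorityCoeff J D k ≠ y} ≤
      Real.exp (-(h ^ 2 / 2 * (n * (marginal π).real (dyadicCell J k)))) := by
  classical
  have hcell := measurableSet_dyadicCell J k
  have hmeas : ∀ z : Label, MeasurableSet (dyadicCell J k ×ˢ ({z} : Set Label)) :=
    fun z => hcell.prod (measurableSet_singleton z)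
  have hdisj : Disjoint (dyadicCell J k ×ˢ ({y} : Set Label)) (dyadicCell J k ×ˢ {-y}) :=
    Set.disjoint_prod.2 (.inr (Set.disjoint_singleton.2 (neg_label_ne_self y).symm))
  have hle := hπ.measureReal_prod_neg_le hcell hy
  rw [marginal_real_eq_add π hcell y] at hle ⊢
  refine (measureReal_mono fun D hD => ?_).trans
    ((measureReal_card_le_card_le_exp hdisj (hmeas y) (hmeas (-y)) hh0 hh1 hle).trans_eq
      (by rw [Fintype.card_fin]))
  have hcount := cellCount_le_of_majorityCoeff_ne hD
  simpa only [cellCount, Set.mem_prod, Set.mem_singleton_iff, Set.mem_ofPred_eq] using! hcount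

theorem excessRisk_majorityClassifier_le {a A : ℝ} (ha : 0 ≤ a) (hh0 : 0 ≤ h) (hh1 : h < 1)
    (hP : DensityAssumption a A (marginal π)) (hπ : StrongMargin h π) (J : ℕ) :
    excessRisk π (majorityClassifier d n J) ≤
      (marginal π).real (mixedRegion (marginal π) (bayesRule π) J) +
        Real.exp (-(h ^ 2 / 2 * (n * (a * (2 ^ (d * J))⁻¹)))) := by
  set M := mixedRegion (marginal π) (bayesRule π) J
  set E := Real.exp (-(h ^ 2 / 2 * (n * (a * (2 ^ (d * J))⁻¹))))
  have hM : MeasurableSet M := measurableSet_mixedRegion _ _ J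
  have hone : Integrable (M.indicator fun _ => (1 : ℝ)) (marginal π) :=
    (integrable_const _).indicator hM
  calc excessRisk π (majorityClassifier d n J)
      ≤ ∫ x, (Measure.pi fun _ : Fin n => (π : Measure (Cube d × Label))).real
          {D | majorityRule J D x ≠ bayesRule π x} ∂(marginal π) := excessRisk_le_integral π _
    _ ≤ ∫ x, (M.indicator (fun _ => (1 : ℝ)) x + E) ∂(marginal π) := by
        refine integral_mono_ae (integrable_measureReal_section_right
          (measurableSet_toFun_ne (majorityClassifier d n J) (measurable_bayesRule π)))
          (hone.add (integrable_const _)) ?_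
        filter_upwards [ae_eventuallyEq_of_notMem_mixedRegion (marginal π) (bayesRule π) J]
          with x hx
        by_cases hxM : x ∈ M
        · rw [Set.indicator_of_mem hxM]
          exact measureReal_le_one.trans (le_add_of_nonneg_right (Real.exp_nonneg _))
        · rw [Set.indicator_of_notMem hxM, zero_add]
          simp only [majorityRule_eq]
          refine (hπ.measureReal_majorityCoeff_ne_le hh0 hh1 (hx hxM)).trans ?_
          simp only [E, ← volume_real_dyadicCell (cellIndex J x)]
          gcongr
          exact hP.mul_volume_real_le ha _
    _ = _ := by
        rw [integral_add hone (integrable_const _), integral_indicator_const _ hM]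
        simp

end Majority

/-! ### The rank of the majority vote -/

section Rank

variable {d n : ℕ} {a : ℝ}

theorem referenceRank_eq_clog (ha : 0 ≤ a) :
    referenceRank d a n = Int.clog (2 ^ d) (a * n / (2 ^ d * Real.log n)) := by
  rw [← Real.ceil_logb_natCast (by positivity), referenceRank, Real.logb]
  push_cast
  rw [Real.log_pow]

theorem div_le_zpow_referenceRank (hd : 1 ≤ d) (ha : 0 ≤ a) :
    a * n / (2 ^ d * Real.log n) ≤ ((2 : ℝ) ^ d) ^ referenceRank d a n := by
  have hle := Int.self_le_zpow_clog (b := 2 ^ d) (Nat.one_lt_two_pow (by lia))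
    (a * n / (2 ^ d * Real.log n))
  rwa [← referenceRank_eq_clog ha, Nat.cast_pow, Nat.cast_ofNat] at hle

theorem zpow_referenceRank_lt (hd : 1 ≤ d) (ha : 0 < a) (hn : 2 ≤ n) :
    ((2 : ℝ) ^ d) ^ referenceRank d a n < a * n / Real.log n := by
  have hlog : 0 < Real.log n := Real.log_pos (Nat.one_lt_cast.2 hn)
  have hlt := Int.zpow_pred_clog_lt_self (b := 2 ^ d) (r := a * n / (2 ^ d * Real.log n))
    (Nat.one_lt_two_pow (by lia)) (by positivity)
  rw [← referenceRank_eq_clog ha.le, Nat.cast_pow, Nat.cast_ofNat,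
    zpow_sub_one₀ (by positivity), ← div_eq_mul_inv, div_lt_iff₀ (by positivity)] at hlt
  exact hlt.trans_eq (by field_simp)

theorem tendsto_referenceRank (hd : 1 ≤ d) (ha : 0 < a) :
    Tendsto (fun n : ℕ => (referenceRank d a n : ℝ)) atTop atTop := by
  have hlog : Tendsto (fun x : ℝ => Real.log x / x) atTop (nhdsWithin 0 (Set.Ioi 0)) := by
    refine tendsto_nhdsWithin_iff.2 ⟨Real.isLittleO_log_id_atTop.tendsto_div_nhds_zero, ?_⟩
    filter_upwards [eventually_gt_atTop 1] with x hx
    exact div_pos (Real.log_pos hx) (by linarith)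
  have hquot : Tendsto (fun n : ℕ => a * n / (2 ^ d * Real.log n)) atTop atTop := by
    refine ((hlog.inv_tendsto_nhdsGT_zero.comp tendsto_natCast_atTop_atTop).const_mul_atTop
      (show 0 < a / 2 ^ d by positivity)).congr fun n => ?_
    rw [Function.comp_apply, Pi.inv_apply, inv_div, mul_div_mul_comm]
  have hd' : (0 : ℝ) < d := Nat.cast_pos.2 hd
  have hlog2 : 0 < Real.log 2 := Real.log_pos one_lt_two
  exact tendsto_atTop_mono (fun n => Int.le_ceil _)
    ((Real.tendsto_log_atTop.comp hquot).atTop_div_const (by positivity))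

theorem log_div_le_referenceRank (hd : 1 ≤ d) (ha : 0 < a) (hn : 2 ≤ n) :
    Real.log (a / 2 ^ d) / (d * Real.log 2) ≤ referenceRank d a n := by
  have hlog : 0 < Real.log n := Real.log_pos (Nat.one_lt_cast.2 hn)
  have hd' : (0 : ℝ) < d := Nat.cast_pos.2 hd
  have hlog2 : 0 < Real.log 2 := Real.log_pos one_lt_two
  have hle : a / 2 ^ d ≤ a * n / (2 ^ d * Real.log n) := by
    rw [mul_div_mul_comm]
    exact le_mul_of_one_le_right (by positivity)
      ((one_le_div hlog).2 (Real.log_le_self n.cast_nonneg))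
  exact (div_le_div_of_nonneg_right (Real.log_le_log (by positivity) hle)
    (by positivity)).trans (Int.le_ceil _)

theorem hasReferenceOrder_toNat_referenceRank_sub (hd : 1 ≤ d) (ha : 0 < a) (m : ℕ) :
    HasReferenceOrder d a fun n => (referenceRank d a n - m).toNat := by
  set b := Real.log (a / 2 ^ d) / (d * Real.log 2)
  have hbound : ∀ n : ℕ, 2 ≤ n →
      |((referenceRank d a n - m).toNat : ℝ) - referenceRank d a n| ≤ |b| + m := fun n hn => by
    have hb := (neg_abs_le b).trans (log_div_le_referenceRank hd ha hn)
    have hcast : ((referenceRank d a n - m).toNat : ℝ) = max (referenceRank d a n - m : ℝ) 0 := by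
      exact_mod_cast congrArg (Int.cast (R := ℝ)) (Int.toNat_eq_max (referenceRank d a n - m))
    have hm : (0 : ℝ) ≤ m := m.cast_nonneg
    rw [hcast, abs_le]
    rcases le_total (referenceRank d a n - m : ℝ) 0 with h | h
    · rw [max_eq_right h]
      constructor <;> linarith [abs_nonneg b]
    · rw [max_eq_left h]
      constructor <;> linarith [abs_nonneg b]
  refine ⟨IsEquivalent.isTheta (IsBigO.trans_isLittleO (g := fun _ => (1 : ℝ)) ?_ ?_),
    |b| + m, hbound⟩
  · refine IsBigO.of_bound (|b| + m) ?_
    filter_upwards [eventually_ge_atTop 2] with n hn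
    simpa using hbound n hn
  · exact isLittleO_const_left.2
      (Or.inr (tendsto_norm_atTop_atTop.comp (tendsto_referenceRank hd ha)))

theorem inv_two_pow_toNat_referenceRank_sub_le (hd : 1 ≤ d) (ha : 0 < a) (hn : 2 ≤ n) (m : ℕ) :
    ((2 ^ (d * (referenceRank d a n - m).toNat))⁻¹ : ℝ) ≤
      (2 ^ d) ^ m * (2 ^ d / a) * (Real.log n / n) := by
  have hlog : 0 < Real.log n := Real.log_pos (Nat.one_lt_cast.2 hn)
  set L := referenceRank d a n
  have hpow : ((2 : ℝ) ^ d) ^ (L - m) ≤ 2 ^ (d * (L - m).toNat) := by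
    rw [pow_mul, ← zpow_natCast]
    exact zpow_le_zpow_right₀ (one_le_pow₀ one_le_two) (Int.self_le_toNat _)
  rw [zpow_sub₀ (by positivity), zpow_natCast] at hpow
  calc ((2 ^ (d * (L - m).toNat))⁻¹ : ℝ)
      ≤ (a * n / (2 ^ d * Real.log n) / (2 ^ d) ^ m)⁻¹ := by
        gcongr
        exact le_trans (by gcongr; exact div_le_zpow_referenceRank hd ha.le) hpow
    _ = _ := by field_simp

theorem exp_toNat_referenceRank_sub_le (hd : 1 ≤ d) (ha : 0 < a) (hn : 2 ≤ n) {κ : ℝ}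
    (hκ : 0 < κ) {m : ℕ} (hm : 1 ≤ κ * (2 ^ d) ^ m) :
    Real.exp (-(κ * (n * (a * (2 ^ (d * (referenceRank d a n - m).toNat))⁻¹)))) ≤
      (1 + (κ * a)⁻¹) / n := by
  have hlog : 0 < Real.log n := Real.log_pos (Nat.one_lt_cast.2 hn)
  have hn0 : (0 : ℝ) < n := Nat.cast_pos.2 (by lia)
  have hrank := zpow_referenceRank_lt hd ha hn
  set L := referenceRank d a n
  rcases le_total (m : ℤ) L with h | h
  · have hpow : (2 : ℝ) ^ (d * (L - m).toNat) * (2 ^ d) ^ m = (2 ^ d) ^ L := by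
      rw [pow_mul, ← zpow_natCast ((2 : ℝ) ^ d), Int.toNat_of_nonneg (by lia),
        ← zpow_natCast ((2 : ℝ) ^ d), ← zpow_add₀ (by positivity), sub_add_cancel]
    set q : ℝ := 2 ^ (d * (L - m).toNat)
    have hq : 0 < q := by positivity
    have hexponent : Real.log n ≤ κ * (n * (a * q⁻¹)) := by
      rw [lt_div_iff₀ hlog, ← hpow] at hrank
      calc Real.log n ≤ κ * (2 ^ d) ^ m * Real.log n := le_mul_of_one_le_left hlog.le hm
        _ = κ * (q * (2 ^ d) ^ m * Real.log n) * q⁻¹ := by field_simp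
        _ ≤ κ * (a * n) * q⁻¹ := by gcongr
        _ = _ := by ring
    calc Real.exp (-(κ * (n * (a * q⁻¹)))) ≤ Real.exp (-Real.log n) := by gcongr
      _ = 1 / n := by rw [Real.exp_neg, Real.exp_log hn0, one_div]
      _ ≤ _ := by gcongr; exact le_add_of_nonneg_right (by positivity)
  · rw [Int.toNat_of_nonpos (by lia), mul_zero, pow_zero, inv_one, mul_one, Real.exp_neg]
    calc (Real.exp (κ * (n * a)))⁻¹ ≤ (κ * (n * a))⁻¹ := by
          gcongr
          linarith [Real.add_one_le_exp (κ * (n * a))]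
      _ = (κ * a)⁻¹ / n := by field_simp
      _ ≤ _ := by gcongr; linarith

theorem exists_hasReferenceOrder_le (hd : 1 ≤ d) {κ : ℝ} (ha : 0 < a) (hκ : 0 < κ) :
    ∃ J : ℕ → ℕ, HasReferenceOrder d a J ∧ ∃ C₁ C₂ : ℝ, 0 < C₁ ∧ 0 < C₂ ∧ ∀ n : ℕ, 2 ≤ n →
      ((2 ^ (d * J n))⁻¹ : ℝ) ≤ C₁ * (Real.log n / n) ∧
      Real.exp (-(κ * (n * (a * (2 ^ (d * J n))⁻¹)))) ≤ C₂ * (Real.log n / n) := by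
  obtain ⟨m, hm⟩ := pow_unbounded_of_one_lt κ⁻¹
    (one_lt_pow₀ (one_lt_two (α := ℝ)) (Nat.one_le_iff_ne_zero.1 hd))
  have hlog2 : 0 < Real.log 2 := Real.log_pos one_lt_two
  refine ⟨_, hasReferenceOrder_toNat_referenceRank_sub hd ha m, (2 ^ d) ^ m * (2 ^ d / a),
    (1 + (κ * a)⁻¹) / Real.log 2, by positivity, by positivity, fun n hn =>
    ⟨inv_two_pow_toNat_referenceRank_sub_le hd ha hn m, ?_⟩⟩
  have hlog : Real.log 2 ≤ Real.log n := Real.log_le_log zero_lt_two (Nat.ofNat_le_cast.2 hn)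
  refine (exp_toNat_referenceRank_sub_le hd ha hn hκ
    ((inv_le_iff_one_le_mul₀' hκ).1 hm.le)).trans ?_
  rw [div_mul_div_comm, mul_comm (Real.log 2), ← div_mul_div_comm]
  exact le_mul_of_one_le_right (by positivity) ((one_le_div hlog2).2 hlog)

end Rank

theorem exists_hasReferenceOrder_worstRisk_le {d : ℕ} (hd : 1 ≤ d) {h a A W α : ℝ} (hh0 : 0 < h)
    (hh1 : h < 1) (ha : 0 < a) (hA : 0 ≤ A) (hW : 0 ≤ W) (hα0 : 0 ≤ α) (hα1 : α < 1) {w : ℕ → ℝ}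
    (hw : ∀ j, w j ≤ W * (2 : ℝ) ^ ((d : ℝ) * α * j)) :
    ∃ J : ℕ → ℕ, HasReferenceOrder d a J ∧ ∃ C : ℝ, 0 < C ∧ ∀ n : ℕ, 2 ≤ n →
      worstRisk (model d w h a A) (majorityClassifier d n (J n)) ≤
        ((C * (Real.log n / n) ^ (1 - α) : ℝ) : EReal) := by
  obtain ⟨J, hJ, C₁, C₂, hC₁, hC₂, hbound⟩ :=
    exists_hasReferenceOrder_le (κ := h ^ 2 / 2) hd ha (by positivity)
  set B := A * W * (1 - (2 : ℝ) ^ (-((d : ℝ) * (1 - α))))⁻¹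
  have hB0 : 0 ≤ B := by
    have : (2 : ℝ) ^ (-((d : ℝ) * (1 - α))) ≤ 1 := Real.rpow_le_one_of_one_le_of_nonpos one_le_two
      (neg_nonpos.2 (mul_nonneg d.cast_nonneg (by linarith)))
    exact mul_nonneg (mul_nonneg hA hW) (inv_nonneg.2 (by linarith))
  refine ⟨J, hJ, B * C₁ ^ (1 - α) + C₂, by positivity, fun n hn => ?_⟩
  refine iSup₂_le fun π ⟨hP, hm, hf⟩ => EReal.coe_le_coe_iff.2 ?_
  obtain ⟨hrank, hexp⟩ := hbound n hn
  have hn0 : (0 : ℝ) < n := Nat.cast_pos.2 (by lia)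
  set x := Real.log n / n
  have hx0 : 0 < x := div_pos (Real.log_pos (Nat.one_lt_cast.2 hn)) hn0
  have hx1 : x ≤ 1 := (div_le_one hn0).2 (Real.log_le_self hn0.le)
  calc excessRisk π (majorityClassifier d n (J n)) ≤ _ :=
        excessRisk_majorityClassifier_le ha.le hh0.le hh1 hP hm (J n)
    _ ≤ B * ((2 ^ (d * J n))⁻¹ : ℝ) ^ (1 - α) + C₂ * x :=
        add_le_add (hP.measureReal_mixedRegion_le hA hW hd hα1 hw hf (J n)) hexp
    _ ≤ B * (C₁ * x) ^ (1 - α) + C₂ * x ^ (1 - α) := by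
        gcongr
        exact Real.self_le_rpow_of_le_one hx0.le hx1 (by linarith)
    _ = _ := by
        rw [Real.mul_rpow hC₁.le hx0.le]
        ring

/-! ### Laws with constant noise -/

section NoisyLaw

/-- The conditional law of a label equal to `f x` with probability `p` and to `-f x` otherwise. -/
noncomputable def noisyKernel {d : ℕ} (f : Cube d → Label) (hf : Measurable f) (p : I) :
    Kernel (Cube d) Label :=
  (Kernel.ofFunOfCountable fun y : Label => bernoulliMeasure y (-y) p).comap f hf

variable {d : ℕ} (P : Measure (Cube d)) [IsProbabilityMeasure P] {f f' : Cube d → Label}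
  (hf : Measurable f) (hf' : Measurable f') (p : I)

theorem noisyKernel_apply (x : Cube d) :
    noisyKernel f hf p x = bernoulliMeasure (f x) (-f x) p := rfl

instance : IsMarkovKernel (noisyKernel f hf p) :=
  ⟨fun x => by rw [noisyKernel_apply]; infer_instance⟩

/-- The joint law of `X` with distribution `P` and of a label `Y` equal to `f X` with probability
`p` and to `-f X` otherwise; the alternatives of the lower bound are of this form. -/
noncomputable def noisyLaw (f : Cube d → Label) (hf : Measurable f) (p : I) :
    ProbabilityMeasure (Cube d × Label) :=
  ⟨P ⊗ₘ noisyKernel f hf p, inferInstance⟩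

theorem marginal_noisyLaw : marginal (noisyLaw P f hf p) = P :=
  Measure.fst_compProd P _

theorem two_mul_eta_noisyLaw_sub_one :
    ∀ᵐ x ∂P, 2 * eta (noisyLaw P f hf p) x - 1 = (2 * p - 1) * ((f x : ℤ) : ℝ) := by
  filter_upwards [condKernel_compProd P (noisyKernel f hf p)] with x hx
  change 2 * ((P ⊗ₘ noisyKernel f hf p).condKernel x).real {1} - 1 = _
  classical
  rw [hx, noisyKernel_apply, bernoulliMeasure_real_apply p (measurableSet_singleton _)]
  rcases Int.units_eq_one_or (f x) with h | h
  · simp [h]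
  · simp [h]
    ring

theorem bayesRule_noisyLaw (hp : (1 / 2 : ℝ) < p) :
    bayesRule (noisyLaw P f hf p) =ᵐ[P] f := by
  filter_upwards [two_mul_eta_noisyLaw_sub_one P hf p] with x hx
  rw [bayesRule, hx]
  rcases Int.units_eq_one_or (f x) with h | h
  · rw [h, if_pos (by simp; linarith)]
  · rw [h, if_neg (by simp; linarith)]

theorem strongMargin_noisyLaw {h : ℝ} (hp : h < 2 * p - 1) :
    StrongMargin h (noisyLaw P f hf p) := by
  rw [StrongMargin, marginal_noisyLaw]
  filter_upwards [two_mul_eta_noisyLaw_sub_one P hf p] with x hx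
  have habs : |((f x : ℤ) : ℝ)| = 1 := by exact_mod_cast Int.isUnit_iff_abs_eq.1 (f x).isUnit
  rw [hx, abs_mul, habs, mul_one]
  exact hp.trans_le (le_abs_self _)

theorem densityAssumption_volume {a A : ℝ} (ha : a ≤ 1) (hA : 1 ≤ A) :
    DensityAssumption a A (volume : Measure (Cube d)) := by
  refine ⟨Measure.AbsolutelyContinuous.rfl, ?_⟩
  filter_upwards [Measure.rnDeriv_self (volume : Measure (Cube d))] with x hx
  rw [hx]
  exact ⟨ENNReal.ofReal_le_one.2 ha, ENNReal.one_le_ofReal.2 hA⟩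

theorem noisyLaw_mem_model {a A h : ℝ} (ha : a ≤ 1) (hA : 1 ≤ A) {w : ℕ → ℝ}
    (hp : (1 / 2 : ℝ) < p) (hhp : h < 2 * p - 1) (hfw : f ∈ sparseClass w volume) :
    noisyLaw volume f hf p ∈ model d w h a A := by
  refine ⟨?_, strongMargin_noisyLaw volume hf p hhp, ?_⟩
  · rw [marginal_noisyLaw]
    exact densityAssumption_volume ha hA
  · obtain ⟨c, hc, hcard, hsum⟩ := hfw
    rw [marginal_noisyLaw]
    refine ⟨c, hc, hcard, ?_⟩
    filter_upwards [hsum, bayesRule_noisyLaw volume hf p hp] with x hx hbayes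
    rw [hbayes, hx]

theorem noisyLaw_restrict_congr {B : Set (Cube d)} (hB : MeasurableSet B) (h : Set.EqOn f f' B) :
    (noisyLaw P f hf p : Measure (Cube d × Label)).restrict (B ×ˢ Set.univ) =
      (noisyLaw P f' hf' p : Measure (Cube d × Label)).restrict (B ×ˢ Set.univ) := by
  refine Measure.ext fun S hS => ?_
  have hSB := hS.inter (hB.prod (MeasurableSet.univ (α := Label)))
  rw [Measure.restrict_apply hS, Measure.restrict_apply hS]
  change (P ⊗ₘ noisyKernel f hf p) _ = (P ⊗ₘ noisyKernel f' hf' p) _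
  rw [Measure.compProd_apply hSB, Measure.compProd_apply hSB]
  refine lintegral_congr fun x => ?_
  by_cases hx : x ∈ B
  · rw [noisyKernel_apply, noisyKernel_apply, h hx]
  · have hempty : Prod.mk x ⁻¹' (S ∩ B ×ˢ Set.univ) = ∅ := by
      ext y
      simp [hx]
    rw [hempty, measure_empty, measure_empty]

end NoisyLaw

/-! ### Assouad's lower bound over hypercubes of rules -/

section Hypercube

variable {d n J : ℕ}

theorem one_sub_measureReal_pow_le_add (P : Measure (Cube d)) [IsProbabilityMeasure P]
    {f f' : Cube d → Label} (hf : Measurable f) (hf' : Measurable f') (p : I) {B : Set (Cube d)}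
    (hB : MeasurableSet B) (h : Set.EqOn f f' Bᶜ) (g : (Fin n → Cube d × Label) → Label)
    (y : Label) :
    (1 - P.real B) ^ n ≤
      (Measure.pi fun _ => (noisyLaw P f hf p : Measure (Cube d × Label))).real {D | g D ≠ y} +
      (Measure.pi fun _ => (noisyLaw P f' hf' p : Measure (Cube d × Label))).real
        {D | g D ≠ -y} := by
  have hcompl : {D | g D ≠ -y} = {D | g D ≠ y}ᶜ := by
    ext D
    simp [Int.units_ne_iff_eq_neg]
  -- Without an observation in `B`, the samples from both laws have the same distribution.
  set E : Set (Fin n → Cube d × Label) := Set.univ.pi fun _ => Bᶜ ×ˢ Set.univ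
  have hE : MeasurableSet E :=
    .univ_pi fun _ => hB.compl.prod MeasurableSet.univ
  have hmass : (Measure.pi fun _ => (noisyLaw P f hf p : Measure (Cube d × Label))).real E =
      (1 - P.real B) ^ n := by
    have hcell : (noisyLaw P f hf p : Measure (Cube d × Label)).real (Bᶜ ×ˢ Set.univ) =
        1 - P.real B := by
      rw [← probReal_compl_eq_one_sub hB, Set.prod_univ, Measure.real,
        ← Measure.fst_apply hB.compl]
      exact congrArg (fun μ : Measure (Cube d) => μ.real Bᶜ) (marginal_noisyLaw P hf p)
    rw [Measure.real, Measure.pi_pi, ENNReal.toReal_prod]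
    simp only [Finset.prod_const, Finset.card_univ, Fintype.card_fin]
    exact congrArg (· ^ n) hcell
  rw [hcompl, ← hmass]
  refine measureReal_le_add_compl_of_restrict_eq hE ?_ _
  rw [Measure.restrict_pi_pi, Measure.restrict_pi_pi]
  simp only [noisyLaw_restrict_congr P hf hf' p hB.compl h]

open Classical in
/-- The rule with label `τ k` on the cells of frequency `J` and index `k ∈ T`, and `-1`
elsewhere: the hypercube of rules indexed by `τ` to which Assouad's method is applied. -/
noncomputable def hypercubeRule (T : Finset (Fin d → Fin (2 ^ J)))
    (τ : (Fin d → Fin (2 ^ J)) → Label) (x : Cube d) : Label :=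
  if cellIndex J x ∈ T then τ (cellIndex J x) else -1

variable (T : Finset (Fin d → Fin (2 ^ J)))

theorem measurable_hypercubeRule (τ : (Fin d → Fin (2 ^ J)) → Label) :
    Measurable (hypercubeRule T τ) := by
  classical
  exact (Measurable.of_discrete (f := fun k => if k ∈ T then τ k else -1)).comp
    (measurable_cellIndex J)

theorem card_mul_le_sum_measureReal_ne_hypercubeRule (p : I)
    (g : (Fin n → Cube d × Label) → Label) {x : Cube d} (hx : cellIndex J x ∈ T) :
    Fintype.card ((Fin d → Fin (2 ^ J)) → Label) * ((1 - (2 ^ (d * J) : ℝ)⁻¹) ^ n / 2) ≤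
      ∑ τ, (Measure.pi fun _ => (noisyLaw volume (hypercubeRule T τ)
        (measurable_hypercubeRule T τ) p : Measure (Cube d × Label))).real
          {D | g D ≠ hypercubeRule T τ x} := by
  classical
  set k := cellIndex J x with hk
  refine card_mul_le_sum_of_involutive (s := fun τ => Function.update τ k (-τ k))
    (fun τ => by simp) fun τ => ?_
  have hflip : hypercubeRule T (Function.update τ k (-τ k)) x = -hypercubeRule T τ x := by
    simp [hypercubeRule, ← hk, hx]
  rw [hflip, ← volume_real_dyadicCell k]
  refine one_sub_measureReal_pow_le_add volume _ _ p (measurableSet_dyadicCell J k)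
    (fun z hz => ?_) g _
  rw [Set.mem_compl_iff, mem_dyadicCell_iff] at hz
  simp [hypercubeRule, Function.update_of_ne hz]

theorem exists_mul_le_excessRisk_noisyLaw_hypercubeRule {h : ℝ} (hh : 0 ≤ h) {p : I}
    (hp : (1 / 2 : ℝ) < p) (hhp : h < 2 * p - 1) (g : Classifier d n) :
    ∃ τ, h * (T.card * (2 ^ (d * J) : ℝ)⁻¹ * ((1 - (2 ^ (d * J) : ℝ)⁻¹) ^ n / 2)) ≤
      excessRisk (noisyLaw volume (hypercubeRule T τ) (measurable_hypercubeRule T τ) p) g := by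
  set π := fun τ => noisyLaw volume (hypercubeRule T τ) (measurable_hypercubeRule T τ) p
  set F := fun τ x => (Measure.pi fun _ : Fin n => (π τ : Measure (Cube d × Label))).real
    {D | g.toFun D x ≠ hypercubeRule T τ x} with hF
  have hint : ∀ τ, Integrable (F τ) volume := fun τ => integrable_measureReal_section_right
    (measurableSet_toFun_ne g (measurable_hypercubeRule T τ))
  set c : ℝ := (1 - (2 ^ (d * J) : ℝ)⁻¹) ^ n / 2
  have hsum : ∑ _τ : (Fin d → Fin (2 ^ J)) → Label, T.card * (2 ^ (d * J) : ℝ)⁻¹ * c ≤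
      ∑ τ, ∫ x, F τ x := by
    rw [← integral_finsetSum _ fun τ _ => hint τ, Finset.sum_const, nsmul_eq_mul,
      Finset.card_univ, mul_left_comm, ← volume_real_preimage_cellIndex, ← smul_eq_mul,
      ← setIntegral_const]
    refine (setIntegral_mono_on (integrable_const _).integrableOn
      (integrable_finsetSum _ fun τ _ => hint τ).integrableOn
      (measurable_cellIndex J (Finset.measurableSet T)) fun x hx => ?_).trans
      (setIntegral_le_integral (integrable_finsetSum _ fun τ _ => hint τ)
        (ae_of_all _ fun x => Finset.sum_nonneg fun τ _ => measureReal_nonneg))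
    exact card_mul_le_sum_measureReal_ne_hypercubeRule T p _ hx
  obtain ⟨τ, -, hτ⟩ := Finset.exists_le_of_sum_le Finset.univ_nonempty hsum
  have hmargin : StrongMargin h (π τ) := strongMargin_noisyLaw volume _ p hhp
  refine ⟨τ, (mul_le_mul_of_nonneg_left hτ hh).trans (le_of_eq_of_le ?_
    (hmargin.mul_integral_le_excessRisk g))⟩
  rw [marginal_noisyLaw, integral_congr_ae]
  filter_upwards [bayesRule_noisyLaw volume (measurable_hypercubeRule T τ) p hp] with x hx
  simp only [hF, π, hx]

end Hypercube

/-! ### The canonical decomposition of a locally constant rule -/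

section Canonical

variable {d : ℕ} {f : Cube d → Label} {i j : ℕ} {x y : Cube d}

/-- The rule `f` is constant on the cell of frequency `j` containing `x`. -/
def ConstantAt (f : Cube d → Label) (j : ℕ) (x : Cube d) : Prop :=
  ∀ y, cellIndex j y = cellIndex j x → f y = f x

/-- The cell of frequency `j` containing `x` is maximal among the cells on which `f` is
constant. -/
def MaximalAt (f : Cube d → Label) (j : ℕ) (x : Cube d) : Prop :=
  ConstantAt f j x ∧ ∀ i < j, ¬ ConstantAt f i x

open Classical in
/-- The family of coefficients whose non-zero entries are the values of `f` on its maximal cells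
of constancy; a cell is represented by one of its points. -/
noncomputable def canonicalCoeffs (f : Cube d → Label) : Coeffs d := fun j k =>
  let x := Function.surjInv (cellIndex_surjective j) k
  if MaximalAt f j x then SignType.sign (f x : ℤ) else 0

theorem ConstantAt.mono (h : ConstantAt f i x) (hij : i ≤ j) : ConstantAt f j x :=
  fun y hy => h y (cellIndex_eq_of_le hij hy)

theorem ConstantAt.congr (h : ConstantAt f j x) (hxy : cellIndex j x = cellIndex j y) :
    ConstantAt f j y :=
  fun z hz => (h z (hz.trans hxy.symm)).trans (h y hxy.symm).symm

theorem exists_eq_of_not_constantAt (h : ¬ ConstantAt f j x) (l : Label) :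
    ∃ z, cellIndex j z = cellIndex j x ∧ f z = l := by
  rcases eq_or_ne (f x) l with hx | hx
  · exact ⟨x, rfl, hx⟩
  · unfold ConstantAt at h
    push Not at h
    obtain ⟨y, hy, hne⟩ := h
    rw [Int.units_ne_iff_eq_neg] at hx hne
    exact ⟨y, hy, by rw [hne, hx, neg_neg]⟩

theorem MaximalAt.congr (h : MaximalAt f j x) (hxy : cellIndex j x = cellIndex j y) :
    MaximalAt f j y :=
  ⟨h.1.congr hxy, fun i hi hc => h.2 i hi (hc.congr (cellIndex_eq_of_le hi.le hxy).symm)⟩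

theorem ConstantAt.exists_maximalAt (h : ConstantAt f i x) : ∃ j, MaximalAt f j x := by
  classical
  have hex : ∃ j, ConstantAt f j x := ⟨i, h⟩
  exact ⟨Nat.find hex, Nat.find_spec hex, fun _ => Nat.find_min hex⟩

theorem MaximalAt.canonicalCoeffs_eq (h : MaximalAt f j x) :
    canonicalCoeffs f j (cellIndex j x) = SignType.sign (f x : ℤ) := by
  have hx := Function.surjInv_eq (cellIndex_surjective j) (cellIndex j x)
  rw [canonicalCoeffs, if_pos (h.congr hx.symm), h.1 _ hx]

theorem canonicalCoeffs_ne_zero_iff :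
    canonicalCoeffs f j (cellIndex j x) ≠ 0 ↔ MaximalAt f j x := by
  refine ⟨fun h => ?_, fun h => ?_⟩
  · exact (of_not_not fun hmax => h (if_neg hmax)).congr
      (Function.surjInv_eq (cellIndex_surjective j) (cellIndex j x))
  · rw [h.canonicalCoeffs_eq, sign_ne_zero]
    exact Units.ne_zero _

theorem Below.exists_cellIndex_eq {k : Fin d → Fin (2 ^ i)} {l : Fin d → Fin (2 ^ j)}
    (h : Below k l) : ∃ x, cellIndex i x = k ∧ cellIndex j x = l :=
  let ⟨x, hk, hl⟩ := h.2
  ⟨x, mem_dyadicCell_iff.1 hk, mem_dyadicCell_iff.1 hl⟩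

theorem below_cellIndex (h : i < j) (x : Cube d) : Below (cellIndex i x) (cellIndex j x) :=
  ⟨h, x, mem_dyadicCell_cellIndex i x, mem_dyadicCell_cellIndex j x⟩

theorem exists_below_canonicalCoeffs_eq (hf : ∀ x, ∃ j, ConstantAt f j x)
    (h : ¬ ConstantAt f i x) (l : Label) :
    ∃ (j : ℕ) (k : Fin d → Fin (2 ^ j)),
      Below (cellIndex i x) k ∧ canonicalCoeffs f j k = SignType.sign (l : ℤ) := by
  obtain ⟨z, hz, rfl⟩ := exists_eq_of_not_constantAt h l
  obtain ⟨j, hj⟩ := (hf z).elim fun _ => ConstantAt.exists_maximalAt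
  have hij : i < j := by
    by_contra! hji
    exact h ((hj.1.mono hji).congr hz)
  exact ⟨j, cellIndex j z, hz ▸ below_cellIndex hij z, hj.canonicalCoeffs_eq⟩

theorem writingConvention_canonicalCoeffs (hf : ∀ x, ∃ j, ConstantAt f j x) :
    WritingConvention (canonicalCoeffs f) := by
  constructor
  · intro i j k l hkl hk
    obtain ⟨x, rfl, rfl⟩ := hkl.exists_cellIndex_eq
    by_contra hl
    exact (canonicalCoeffs_ne_zero_iff.1 hl).2 i hkl.1 (canonicalCoeffs_ne_zero_iff.1 hk).1
  · rintro i k ⟨j, l, hkl, hl⟩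
    obtain ⟨x, rfl, rfl⟩ := hkl.exists_cellIndex_eq
    have hx : ¬ ConstantAt f i x := (canonicalCoeffs_ne_zero_iff.1 hl).2 i hkl.1
    exact ⟨by simpa using exists_below_canonicalCoeffs_eq hf hx 1,
      by simpa using exists_below_canonicalCoeffs_eq hf hx (-1)⟩

theorem dyadicSum_canonicalCoeffs (hf : ∀ x, ∃ j, ConstantAt f j x) (x : Cube d) :
    dyadicSum (canonicalCoeffs f) x = (f x : ℤ) := by
  obtain ⟨j, hj⟩ := (hf x).elim fun _ => ConstantAt.exists_maximalAt
  rw [(writingConvention_canonicalCoeffs hf).dyadicSum_eq (canonicalCoeffs_ne_zero_iff.2 hj),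
    hj.canonicalCoeffs_eq]
  rcases Int.units_eq_one_or (f x) with h | h <;> simp [h]

end Canonical

/-! ### Rules supported in a corner cell -/

section Corner

variable {d i₀ i j J : ℕ} {f : Cube d → Label}

theorem cellIndex_zero (j : ℕ) : cellIndex j (0 : Cube d) = 0 :=
  mem_dyadicCell_iff.1 fun i => ⟨by simp, .inl (by simp)⟩

/-- The indices of frequency `j` with all coordinates `< M`. For `M = 2 ^ (j - i)`, these are the
indices of the cells in the corner cell of frequency `i`. -/
def cornerIndices (d j M : ℕ) : Finset (Fin d → Fin (2 ^ j)) :=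
  Fintype.piFinset fun _ => {l | (l : ℕ) < M}

theorem mem_cornerIndices {M : ℕ} {k : Fin d → Fin (2 ^ j)} :
    k ∈ cornerIndices d j M ↔ ∀ i, (k i : ℕ) < M := by
  simp [cornerIndices]

theorem card_cornerIndices {M : ℕ} (h : M ≤ 2 ^ j) : (cornerIndices d j M).card = M ^ d := by
  rw [cornerIndices, Fintype.card_piFinset_const, Fin.card_filter_val_lt, min_eq_right h]

theorem card_erase_zero_cornerIndices {M : ℕ} (h : M ≤ 2 ^ j) (hM : 0 < M) :
    ((cornerIndices d j M).erase 0).card = M ^ d - 1 := by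
  rw [Finset.card_erase_of_mem (mem_cornerIndices.2 fun _ => hM), card_cornerIndices h]

theorem cellIndex_eq_zero_iff (h : i ≤ j) {x : Cube d} :
    cellIndex i x = 0 ↔ cellIndex j x ∈ cornerIndices d j (2 ^ (j - i)) := by
  simp only [mem_cornerIndices, funext_iff, Fin.ext_iff, cellIndex_div h, Pi.zero_apply,
    Fin.val_zero, Nat.div_eq_zero_iff, pow_eq_zero_iff', OfNat.ofNat_ne_zero, false_and, false_or]

/-- A rule which is constant on the cells of frequency `J`, takes the value `1` only in the cell of
frequency `i₀` containing the origin, and takes the value `-1` at the origin. -/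
structure IsCornerRule (i₀ J : ℕ) (f : Cube d → Label) : Prop where
  constantAt : ∀ x, ConstantAt f J x
  cellIndex_eq_zero : ∀ x, f x = 1 → cellIndex i₀ x = 0
  map_zero : f 0 = -1

theorem MaximalAt.le_of_constantAt {x : Cube d} (h : MaximalAt f j x) (hf : ConstantAt f J x) :
    j ≤ J :=
  not_lt.1 fun hlt => h.2 J hlt hf

theorem IsCornerRule.mem_cornerIndices_of_lt (hf : IsCornerRule i₀ J f) {x : Cube d}
    (hx : MaximalAt f j x) (hj : i₀ < j) : cellIndex j x ∈ cornerIndices d j (2 ^ (j - i₀)) := by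
  obtain ⟨z, hz, hz1⟩ := exists_eq_of_not_constantAt (hx.2 i₀ hj) 1
  exact (cellIndex_eq_zero_iff hj.le).1 (hz ▸ hf.cellIndex_eq_zero z hz1)

theorem IsCornerRule.mem_cornerIndices_of_le (hf : IsCornerRule i₀ J f) {x : Cube d}
    (hx : MaximalAt f j x) (hj : 1 ≤ j) (hj' : j ≤ i₀) :
    cellIndex j x ∈ (cornerIndices d j 2).erase 0 := by
  obtain ⟨z, hz, hz1⟩ := exists_eq_of_not_constantAt (hx.2 (j - 1) (by omega)) 1
  have hzero : ∀ m ≤ i₀, cellIndex m z = 0 := fun m hm =>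
    (cellIndex_eq_of_le hm ((hf.cellIndex_eq_zero z hz1).trans (cellIndex_zero i₀).symm)).trans
      (cellIndex_zero m)
  refine Finset.mem_erase.2 ⟨fun h0 => ?_, ?_⟩
  -- The corner cell contains both `z` and the origin, where `f` takes different values.
  · have hz' : f z = f x := hx.1 z ((hzero j hj').trans h0.symm)
    have ho : f 0 = f x := hx.1 0 ((cellIndex_zero j).trans h0.symm)
    rw [← hz', hz1, hf.map_zero] at ho
    exact absurd ho (by decide)
  · have hparent := (cellIndex_eq_zero_iff (Nat.sub_le j 1)).1
      (hz.symm.trans (hzero (j - 1) (by omega)))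
    rwa [Nat.sub_sub_self hj, pow_one] at hparent

theorem card_canonicalCoeffs_ne_zero_le {S : Finset (Fin d → Fin (2 ^ j))}
    (h : ∀ x, MaximalAt f j x → cellIndex j x ∈ S) :
    Nat.card {k : Fin d → Fin (2 ^ j) // canonicalCoeffs f j k ≠ 0} ≤ S.card := by
  classical
  rw [Nat.card_eq_fintype_card, Fintype.card_subtype]
  refine Finset.card_le_card fun k hk => ?_
  obtain ⟨x, rfl⟩ := cellIndex_surjective j k
  exact h x (canonicalCoeffs_ne_zero_iff.1 (Finset.mem_filter.1 hk).2)

theorem IsCornerRule.card_canonicalCoeffs_le (hf : IsCornerRule i₀ J f) {w : ℕ → ℝ}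
    (hw : ∀ j, 0 ≤ w j) (hw0 : 1 ≤ w 0)
    (hw1 : ∀ j, 1 ≤ j → j ≤ i₀ → (2 : ℝ) ^ d - 1 ≤ w j)
    (hw2 : ∀ j, i₀ < j → j ≤ J → (2 : ℝ) ^ (d * (j - i₀)) ≤ w j) (j : ℕ) :
    (Nat.card {k : Fin d → Fin (2 ^ j) // canonicalCoeffs f j k ≠ 0} : ℝ) ≤ w j := by
  rcases lt_or_ge J j with hJj | hjJ
  · have hcard := card_canonicalCoeffs_ne_zero_le (f := f) (j := j) (S := ∅) fun x hx =>
      absurd (hx.le_of_constantAt (hf.constantAt x)) (by omega)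
    exact (Nat.cast_le.2 hcard).trans (by simpa using hw j)
  rcases lt_or_ge i₀ j with hij | hji
  · have hcard := card_canonicalCoeffs_ne_zero_le fun x hx =>
      hf.mem_cornerIndices_of_lt (j := j) hx hij
    rw [card_cornerIndices (Nat.pow_le_pow_right two_pos (Nat.sub_le _ _)), ← pow_mul,
      mul_comm] at hcard
    exact le_trans (mod_cast hcard) (hw2 j hij hjJ)
  rcases Nat.eq_zero_or_pos j with rfl | hj
  · exact hw0.trans' (by simp)
  · have hcard := card_canonicalCoeffs_ne_zero_le fun x hx =>
      hf.mem_cornerIndices_of_le (j := j) hx hj hji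
    rw [card_erase_zero_cornerIndices (Nat.le_self_pow hj.ne' 2) two_pos] at hcard
    refine (Nat.cast_le.2 hcard).trans ?_
    rw [Nat.cast_pred (by positivity)]
    exact_mod_cast hw1 j hj hji

theorem IsCornerRule.mem_sparseClass (hf : IsCornerRule i₀ J f) {w : ℕ → ℝ}
    (hw : ∀ j, 0 ≤ w j) (hw0 : 1 ≤ w 0)
    (hw1 : ∀ j, 1 ≤ j → j ≤ i₀ → (2 : ℝ) ^ d - 1 ≤ w j)
    (hw2 : ∀ j, i₀ < j → j ≤ J → (2 : ℝ) ^ (d * (j - i₀)) ≤ w j) (P : Measure (Cube d)) :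
    f ∈ sparseClass w P := by
  have hconst : ∀ x, ∃ j, ConstantAt f j x := fun x => ⟨J, hf.constantAt x⟩
  exact ⟨_, writingConvention_canonicalCoeffs hconst,
    hf.card_canonicalCoeffs_le hw hw0 hw1 hw2,
    ae_of_all _ fun x => (dyadicSum_canonicalCoeffs hconst x).symm⟩

theorem isCornerRule_hypercubeRule (hi : i₀ ≤ J) (τ : (Fin d → Fin (2 ^ J)) → Label) :
    IsCornerRule i₀ J (hypercubeRule ((cornerIndices d J (2 ^ (J - i₀))).erase 0) τ) where
  constantAt x y hxy := by rw [hypercubeRule, hypercubeRule, hxy]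
  cellIndex_eq_zero x hx := by
    refine (cellIndex_eq_zero_iff hi).2 (Finset.mem_of_mem_erase (a := 0) ?_)
    by_contra hmem
    rw [hypercubeRule, if_neg hmem] at hx
    exact absurd hx (by decide)
  map_zero := if_neg (by simp [cellIndex_zero])

theorem half_le_one_sub_inv_pow {n : ℕ} {m : ℝ} (hm : 1 ≤ m) (hn : 2 * n ≤ m) :
    1 / 2 ≤ (1 - m⁻¹) ^ n := by
  have hbernoulli := one_add_mul_le_pow (a := -m⁻¹) (by linarith [inv_le_one_of_one_le₀ hm]) n
  rw [← sub_eq_add_neg] at hbernoulli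
  have hnm : n * m⁻¹ ≤ 1 / 2 := by
    rw [← div_eq_mul_inv, div_le_div_iff₀ (by positivity) two_pos]
    linarith
  linarith

theorem half_inv_le_card_mul (hd : 1 ≤ d) (hi : i₀ < J) :
    (2 ^ (d * i₀) : ℝ)⁻¹ / 2 ≤
      ((cornerIndices d J (2 ^ (J - i₀))).erase 0).card * (2 ^ (d * J) : ℝ)⁻¹ := by
  obtain ⟨m, rfl⟩ := Nat.exists_eq_add_of_lt hi
  have hm : 2 ≤ 2 ^ (d * (m + 1)) := Nat.le_self_pow (by positivity) 2
  rw [card_erase_zero_cornerIndices (Nat.pow_le_pow_right two_pos (Nat.sub_le _ _))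
    (by positivity), add_assoc, Nat.add_sub_cancel_left, ← pow_mul, mul_comm (m + 1),
    mul_add d i₀, pow_add (2 : ℝ) (d * i₀), Nat.cast_pred (by positivity)]
  have hm' : (2 : ℝ) ≤ 2 ^ (d * (m + 1)) := mod_cast hm
  push_cast
  field_simp
  linarith

theorem le_minimaxExcessRisk {n : ℕ} {h a A : ℝ} (hh0 : 0 ≤ h) (hh1 : h < 1) (ha : a ≤ 1)
    (hA : 1 ≤ A) (hd : 1 ≤ d) (hi : i₀ < J) (hn : (2 * n : ℝ) ≤ 2 ^ (d * J)) {w : ℕ → ℝ}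
    (hw : ∀ j, 0 ≤ w j) (hw0 : 1 ≤ w 0)
    (hw1 : ∀ j, 1 ≤ j → j ≤ i₀ → (2 : ℝ) ^ d - 1 ≤ w j)
    (hw2 : ∀ j, i₀ < j → j ≤ J → (2 : ℝ) ^ (d * (j - i₀)) ≤ w j) :
    ((h / 8 * (2 ^ (d * i₀))⁻¹ : ℝ) : EReal) ≤ minimaxExcessRisk d n (model d w h a A) := by
  refine le_iInf fun g => ?_
  let p : I := ⟨(3 + h) / 4, by linarith, by linarith⟩
  have hp : (1 / 2 : ℝ) < p := show 1 / 2 < (3 + h) / 4 by linarith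
  have hhp : h < 2 * p - 1 := show h < 2 * ((3 + h) / 4) - 1 by linarith
  obtain ⟨τ, hτ⟩ := exists_mul_le_excessRisk_noisyLaw_hypercubeRule
    ((cornerIndices d J (2 ^ (J - i₀))).erase 0) hh0 hp hhp g
  refine le_iSup₂_of_le _ (noisyLaw_mem_model _ p ha hA hp hhp
    ((isCornerRule_hypercubeRule hi.le τ).mem_sparseClass hw hw0 hw1 hw2 volume))
    (EReal.coe_le_coe_iff.2 (hτ.trans' ?_))
  calc h / 8 * (2 ^ (d * i₀))⁻¹ = h * ((2 ^ (d * i₀))⁻¹ / 2 * (1 / 2 / 2)) := by ring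
    _ ≤ _ := by
      gcongr
      · exact half_inv_le_card_mul hd hi
      · exact half_le_one_sub_inv_pow (one_le_pow₀ one_le_two) hn

end Corner

/-! ### The truncated and the exponential classes -/

section Classes

variable {d : ℕ}

theorem exists_two_pow_mul_near (hd : 1 ≤ d) {x : ℝ} (hx : 1 ≤ x) :
    ∃ i : ℕ, 2 ^ (d * i) ≤ x ∧ x < 2 ^ (d * (i + 1)) := by
  simpa only [pow_mul] using
    exists_nat_pow_near hx (one_lt_pow₀ (one_lt_two (α := ℝ)) (Nat.one_le_iff_ne_zero.1 hd))

theorem truncatedWeight_nonneg (K j : ℕ) : 0 ≤ truncatedWeight d K j := by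
  unfold truncatedWeight
  split_ifs <;> positivity

theorem truncatedWeight_le (K j : ℕ) : truncatedWeight d K j ≤ 2 ^ (d * K) := by
  unfold truncatedWeight
  split_ifs with h
  · gcongr
    exact one_le_two
  · exact le_rfl

theorem two_pow_le_truncatedWeight {K j : ℕ} (hK : 1 ≤ K) (hj : 1 ≤ j) :
    2 ^ d ≤ truncatedWeight d K j := by
  unfold truncatedWeight
  split_ifs
  · exact pow_le_pow_right₀ one_le_two (Nat.le_mul_of_pos_right d hj)
  · exact pow_le_pow_right₀ one_le_two (Nat.le_mul_of_pos_right d hK)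

theorem le_minimaxExcessRisk_truncatedWeight {h a A : ℝ} (hh0 : 0 ≤ h) (hh1 : h < 1) (ha : a ≤ 1)
    (hA : 1 ≤ A) (hd : 1 ≤ d) {K : ℕ} (hK : 1 ≤ K) {n : ℕ} (hn : 1 ≤ n) :
    ((h / 16 * (n : ℝ)⁻¹ : ℝ) : EReal) ≤
      minimaxExcessRisk d n (model d (truncatedWeight d K) h a A) := by
  have hn' : (1 : ℝ) ≤ n := mod_cast hn
  obtain ⟨i, hi, hi'⟩ := exists_two_pow_mul_near hd (show 1 ≤ 2 * (n : ℝ) by linarith)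
  refine (le_minimaxExcessRisk hh0 hh1 ha hA hd (Nat.lt_succ_self i) hi'.le
    (truncatedWeight_nonneg K) (by simp [truncatedWeight])
    (fun j hj _ => (sub_le_self _ zero_le_one).trans (two_pow_le_truncatedWeight hK hj))
    fun j hij hji => ?_).trans' (EReal.coe_le_coe_iff.2 ?_)
  · obtain rfl : j = i + 1 := by omega
    simpa using two_pow_le_truncatedWeight (d := d) hK (Nat.le_add_left 1 i)
  · calc h / 16 * (n : ℝ)⁻¹ = h / 8 * (2 * n : ℝ)⁻¹ := by
          field_simp
          ring
      _ ≤ h / 8 * (2 ^ (d * i))⁻¹ := by gcongr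

theorem sub_one_le_two_rpow_expThreshold {α : ℝ} (hα : 0 < α) :
    (2 : ℝ) ^ d - 1 ≤ 2 ^ ((d : ℝ) * α * expThreshold d α) := by
  obtain ⟨N, hN⟩ := exists_nat_ge α⁻¹
  have hαN : 1 ≤ α * N := (inv_le_iff_one_le_mul₀' hα).1 hN
  refine Nat.sInf_mem (s := {N : ℕ | (2 : ℝ) ^ d - 1 ≤ 2 ^ ((d : ℝ) * α * N)}) ⟨N, ?_⟩
  refine (sub_le_self ((2 : ℝ) ^ d) zero_le_one).trans ?_
  rw [← Real.rpow_natCast, mul_assoc]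
  exact Real.rpow_le_rpow_of_exponent_le one_le_two (le_mul_of_one_le_right d.cast_nonneg hαN)

theorem expWeight_nonneg (α : ℝ) (j : ℕ) : 0 ≤ expWeight d α j := by
  unfold expWeight
  split_ifs <;> positivity

theorem expWeight_le {α : ℝ} (hα : 0 ≤ α) (j : ℕ) :
    expWeight d α j ≤ 2 ^ (d * expThreshold d α) * 2 ^ ((d : ℝ) * α * j) := by
  unfold expWeight
  split_ifs with h
  · calc (2 : ℝ) ^ (d * j) ≤ 2 ^ (d * expThreshold d α) := by
          gcongr
          exact one_le_two
      _ ≤ _ := le_mul_of_one_le_right (by positivity)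
          (Real.one_le_rpow one_le_two (by positivity))
  · exact le_mul_of_one_le_left (by positivity) (one_le_pow₀ one_le_two)

theorem sub_one_le_expWeight {α : ℝ} (hα : 0 < α) {j : ℕ} (hj : 1 ≤ j) :
    (2 : ℝ) ^ d - 1 ≤ expWeight d α j := by
  unfold expWeight
  split_ifs with h
  · exact (sub_le_self _ zero_le_one).trans
      (pow_le_pow_right₀ one_le_two (Nat.le_mul_of_pos_right d hj))
  · refine (sub_one_le_two_rpow_expThreshold hα).trans ?_
    gcongr
    · exact one_le_two
    · exact (not_le.1 h).le

theorem two_pow_mul_sub_le_expWeight {α : ℝ} {i j : ℕ} (hij : i ≤ j) (h : (1 - α) * j ≤ i) :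
    2 ^ (d * (j - i)) ≤ expWeight d α j := by
  unfold expWeight
  split_ifs
  · exact pow_le_pow_right₀ one_le_two (Nat.mul_le_mul_left d (Nat.sub_le j i))
  · rw [← Real.rpow_natCast, mul_assoc]
    push_cast [hij]
    gcongr
    · exact one_le_two
    · linarith

theorem exists_corner_frequencies (hd : 1 ≤ d) {α : ℝ} (hα0 : 0 < α) (hα1 : α ≤ 1) :
    ∃ C : ℝ, 0 < C ∧ ∀ n : ℕ, 1 ≤ n → ∃ i₀ J : ℕ, i₀ < J ∧ (2 * n : ℝ) ≤ 2 ^ (d * J) ∧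
      (1 - α) * J ≤ i₀ ∧ 2 ^ (d * i₀) ≤ C * (n : ℝ) ^ (1 - α) := by
  have hβ : 0 ≤ 1 - α := by linarith
  -- Adding `R` frequencies to `J` leaves room for an integer between `(1 - α) J` and `J - 1`.
  set R := ⌈α⁻¹⌉₊
  refine ⟨2 ^ (d * ((1 - α) * (1 + R) + 1)) * 2 ^ (1 - α), by positivity, fun n hn => ?_⟩
  have hn' : (1 : ℝ) ≤ n := mod_cast hn
  obtain ⟨i, hi, hi'⟩ := exists_two_pow_mul_near hd (show 1 ≤ 2 * (n : ℝ) by linarith)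
  have hαR : 1 ≤ α * R := (inv_le_iff_one_le_mul₀' hα0).1 (Nat.le_ceil α⁻¹)
  have hlt : ⌈(1 - α) * (i + 1 + R : ℕ)⌉₊ ≤ i + R := by
    rw [Nat.ceil_le]
    push_cast
    linarith [mul_nonneg hα0.le (by positivity : (0 : ℝ) ≤ i + 1)]
  refine ⟨⌈(1 - α) * (i + 1 + R : ℕ)⌉₊, i + 1 + R, by omega,
    hi'.le.trans (pow_le_pow_right₀ one_le_two (Nat.mul_le_mul_left d (Nat.le_add_right _ _))),
    Nat.le_ceil _, ?_⟩
  have hceil := (Nat.ceil_lt_add_one (mul_nonneg hβ (i + 1 + R : ℕ).cast_nonneg)).le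
  calc (2 : ℝ) ^ (d * ⌈(1 - α) * (i + 1 + R : ℕ)⌉₊)
      ≤ 2 ^ ((d : ℝ) * ((1 - α) * (i + 1 + R : ℕ) + 1)) := by
        rw [← Real.rpow_natCast, Nat.cast_mul]
        gcongr
        exact one_le_two
    _ = 2 ^ (d * ((1 - α) * (1 + R) + 1)) * ((2 : ℝ) ^ (d * i)) ^ (1 - α) := by
        rw [← Real.rpow_natCast, ← Real.rpow_mul two_pos.le, ← Real.rpow_add two_pos]
        push_cast
        ring_nf
    _ ≤ 2 ^ (d * ((1 - α) * (1 + R) + 1)) * (2 * n : ℝ) ^ (1 - α) := by gcongr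
    _ = _ := by rw [Real.mul_rpow two_pos.le n.cast_nonneg, mul_assoc]

theorem exists_le_minimaxExcessRisk_expWeight {h a A : ℝ} (hh0 : 0 < h) (hh1 : h < 1) (ha : a ≤ 1)
    (hA : 1 ≤ A) (hd : 1 ≤ d) {α : ℝ} (hα0 : 0 < α) (hα1 : α ≤ 1) :
    ∃ C₀ : ℝ, 0 < C₀ ∧ ∀ n : ℕ, 1 ≤ n → ((C₀ * (n : ℝ) ^ (-1 + α) : ℝ) : EReal) ≤
      minimaxExcessRisk d n (model d (expWeight d α) h a A) := by
  obtain ⟨C, hC, hfreq⟩ := exists_corner_frequencies hd hα0 hα1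
  refine ⟨h / 8 * C⁻¹, by positivity, fun n hn => ?_⟩
  obtain ⟨i₀, J, hi, hnJ, hJ, hi₀⟩ := hfreq n hn
  refine (le_minimaxExcessRisk hh0.le hh1 ha hA hd hi hnJ (expWeight_nonneg α)
    (by simp [expWeight]) (fun j hj _ => sub_one_le_expWeight hα0 hj)
    fun j hij hjJ => two_pow_mul_sub_le_expWeight hij.le (hJ.trans' ?_)).trans'
    (EReal.coe_le_coe_iff.2 ?_)
  · gcongr
  · have hexp : -1 + α = -(1 - α) := by ring
    rw [hexp, Real.rpow_neg n.cast_nonneg, mul_assoc, ← mul_inv]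
    gcongr

end Classes

end DyadicClassification

theorem mainTheorem1 (h a A : ℝ) (hh0 : 0 < h) (hh1 : h < 1) (ha0 : 0 < a) (ha1 : a ≤ 1)
    (hA : 1 ≤ A) :
    (∀ K : ℕ, 1 ≤ K →
      (∀ d : ℕ, 1 ≤ d → ∃ J : ℕ → ℕ, HasReferenceOrder d a J ∧
        ∃ C : ℝ, 0 < C ∧ ∀ n : ℕ, 2 ≤ n →
          worstRisk (model d (truncatedWeight d K) h a A) (majorityClassifier d n (J n)) ≤
            ((C * (Real.log n / n) : ℝ) : EReal)) ∧
      (∃ C₀ : ℝ, 0 < C₀ ∧ ∀ d : ℕ, 1 ≤ d → ∀ n : ℕ, 1 ≤ n →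
        ((C₀ * (n : ℝ)⁻¹ : ℝ) : EReal) ≤
          minimaxExcessRisk d n (model d (truncatedWeight d K) h a A))) ∧
    (∀ α : ℝ, 0 < α → α < 1 → ∀ d : ℕ, 1 ≤ d →
      (∃ J : ℕ → ℕ, HasReferenceOrder d a J ∧
        ∃ C : ℝ, 0 < C ∧ ∀ n : ℕ, 2 ≤ n →
          worstRisk (model d (expWeight d α) h a A) (majorityClassifier d n (J n)) ≤
            ((C * (Real.log n / n) ^ (1 - α) : ℝ) : EReal)) ∧
      (∃ C₀ : ℝ, 0 < C₀ ∧ ∀ n : ℕ, 1 ≤ n →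
        ((C₀ * (n : ℝ) ^ (-1 + α) : ℝ) : EReal) ≤
          minimaxExcessRisk d n (model d (expWeight d α) h a A))) := by
  refine ⟨fun K hK => ⟨fun d hd => ?_, h / 16, by positivity, fun d hd n hn =>
    le_minimaxExcessRisk_truncatedWeight hh0.le hh1 ha1 hA hd hK hn⟩, fun α hα0 hα1 d hd =>
    ⟨exists_hasReferenceOrder_worstRisk_le hd hh0 hh1 ha0 (by linarith) (by positivity) hα0.le hα1
      (expWeight_le hα0.le),
    exists_le_minimaxExcessRisk_expWeight hh0 hh1 ha1 hA hd hα0 hα1.le⟩⟩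
  have hw : ∀ j, truncatedWeight d K j ≤ 2 ^ (d * K) * 2 ^ ((d : ℝ) * 0 * j) := fun j => by
    simpa using truncatedWeight_le K j
  simpa only [sub_zero, Real.rpow_one] using
    exists_hasReferenceOrder_worstRisk_le hd hh0 hh1 ha0 (by linarith : 0 ≤ A) (by positivity)
      le_rfl one_pos hw
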